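/- Let $\mathcal{E}=(\mathcal{A},\mathcal{S})$ be an exact category in the sense of Quillen, with Yoneda extension groups $\operatorname{Ext}^i_{\mathcal{E}}$. All subcategories are full and closed under isomorphisms. For a subcategory $\mathcal{X}$ let $\mathcal{X}^{\perp}$ be the subcategory of all $M$ with $\operatorname{Ext}^i_{\mathcal{E}}(X,M)=0$ for all $i\ge 1$, $X\in\mathcal{X}$, and for $n\ge 0$ let $\operatorname{Res}_n(\mathcal{X})$ (resp. $\operatorname{Cores}_n(\mathcal{X})$) consist of all $M$ having an exact sequence $0\to X_n\to\cdots\to X_0\to M\to 0$ (resp. $0\to M\to X_0\to\cdots\to X_n\to 0$) with all $X_i\in\mathcal{X}$. $\mathcal{X}$ is self-orthogonal if $\mathcal{X}\subset\mathcal{X}^{\perp}$. An extension-closed subcategory $\mathcal{X}$ is regarded as an exact category with the short exact sequences of $\mathcal{E}$ having all three terms in $\mathcal{X}$ (a fully exact subcategory); $\operatorname{Res}_{\mathcal{X},m}$ and $\operatorname{Cores}_{\mathcal{X},m}$ denote $\operatorname{Res}_m$ and $\operatorname{Cores}_m$ formed inside it. A subcategory $\mathcal{T}$ is *tilting* in $\mathcal{E}$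 if it is self-orthogonal, the fully exact subcategory $\mathcal{T}^{\perp}$ has enough projectives and its projective objects are exactly the objects of $\mathcal{T}$, and $\mathcal{T}^{\perp}$ is finitely coresolving: it is closed under extensions and under cokernels of inflations between its objects, every object of $\mathcal{E}$ admits an inflation into an object of $\mathcal{T}^{\perp}$, and $\mathcal{E}=\bigcup_{n\ge 1}\operatorname{Cores}_n(\mathcal{T}^{\perp})$. It is *$n$-tilting* if moreover $\operatorname{Cores}_n(\mathcal{T}^{\perp})=\mathcal{E}$. **Proposition.** (1) Let $\mathcal{T}$ be an $n$-tilting subcategory of $\mathcal{E}$ for some $n\geq 0$, and let $\widetilde{\mathcal{T}}$ be an additive subcategory of $\mathcal{E}$ (containing $0$ and closed under finite direct sums) which is self-orthogonal and closed under direct summands. The following are equivalent: (a) $\widetilde{\mathcal{T}}$ is an $m$-tilting subcategory of $\mathcal{E}$ for some $m\ge 0$, and $\widetilde{\mathcal{T}}^{\perp}\subset\mathcal{T}^{\perp}$; (b) $\widetilde{\mathcal{T}}$ is an $m$-tilting subcategory of $\mathcal{E}$ for some $m\ge 0$, and $\widetilde{\mathcal{T}}\subset\mathcal{T}^{\perp}$;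 (c) $\widetilde{\mathcal{T}}\subset\mathcal{T}^{\perp}$ and $\widetilde{\mathcal{T}}$ is an $m$-tilting subcategory of the fully exact subcategory $\mathcal{T}^{\perp}$ for some $m\ge 0$; (d) there is an $m\ge 0$ with $\widetilde{\mathcal{T}}\subset\operatorname{Res}_{\mathcal{T}^{\perp},m}(\mathcal{T})$ and $\mathcal{T}\subset\operatorname{Cores}_{\mathcal{T}^{\perp},m}(\widetilde{\mathcal{T}})$. In this case we write $\widetilde{\mathcal{T}}\le\mathcal{T}$. (2) Inclusion of perpendicular categories, $\widetilde{\mathcal{T}}^{\perp}\subset\mathcal{T}^{\perp}$, is a partial order on all tilting subcategories of $\mathcal{E}$; likewise $\le$ is a partial order on the subcategories that are $n$-tilting for some $n\ge 0$. (3) If $\mathcal{T}$ is $n$-tilting and $\widetilde{\mathcal{T}}$ is $m$-tilting for some $n,m\ge 0$, and $\widetilde{\mathcal{T}}\subset\mathcal{T}$, then $\widetilde{\mathcal{T}}=\mathcal{T}$. -/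

import Mathlib

open CategoryTheory CategoryTheory.Limits

universe v u

namespace ExactCat

variable {C : Type u} [Category.{v} C] [Preadditive C]

/-! Throughout, a class of short exact sequences (conflations) on an additive category is a property
`S` of short complexes. The notions below are defined for any such class, so that they can be used
for an exact category as well as for its fully exact subcategories. -/

/-- `i` is an inflation: the first map of a short exact sequence. -/
def Inflation (S : ObjectProperty (ShortComplex C)) {A B : C} (i : A ⟶ B) : Prop :=
  ∃ (Z : C) (p : B ⟶ Z) (w : i ≫ p = 0), S (ShortComplex.mk i p w)

/-- `p` is a deflation: the second map of a short exact sequence. -/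
def Deflation (S : ObjectProperty (ShortComplex C)) {B Z : C} (p : B ⟶ Z) : Prop :=
  ∃ (A : C) (i : A ⟶ B) (w : i ≫ p = 0), S (ShortComplex.mk i p w)

/-- The axioms of a Quillen exact structure: `S` is an isomorphism-closed class of kernel-cokernel
pairs, identities are inflations and deflations, inflations and deflations are closed under
composition, pushouts of inflations along arbitrary morphisms exist and are inflations, and
pullbacks of deflations along arbitrary morphisms exist and are deflations. -/
structure IsExactStructure (S : ObjectProperty (ShortComplex C)) : Prop where
  of_iso : ∀ {E F : ShortComplex C}, Nonempty (E ≅ F) → S E → S F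
  isKernel : ∀ E : ShortComplex C, S E → Nonempty (IsLimit (KernelFork.ofι E.f E.zero))
  isCokernel : ∀ E : ShortComplex C, S E → Nonempty (IsColimit (CokernelCofork.ofπ E.g E.zero))
  inflation_id : ∀ A : C, Inflation S (𝟙 A)
  deflation_id : ∀ A : C, Deflation S (𝟙 A)
  inflation_comp : ∀ {A B D : C} (i : A ⟶ B) (j : B ⟶ D),
    Inflation S i → Inflation S j → Inflation S (i ≫ j)
  deflation_comp : ∀ {A B D : C} (p : A ⟶ B) (q : B ⟶ D),
    Deflation S p → Deflation S q → Deflation S (p ≫ q)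
  pushout : ∀ {A B A₁ : C} (i : A ⟶ B) (f : A ⟶ A₁), Inflation S i →
    ∃ (B₁ : C) (g : B ⟶ B₁) (i₁ : A₁ ⟶ B₁), IsPushout i f g i₁ ∧ Inflation S i₁
  pullback : ∀ {B Z Z₁ : C} (p : B ⟶ Z) (f : Z₁ ⟶ Z), Deflation S p →
    ∃ (B₁ : C) (g : B₁ ⟶ B) (p₁ : B₁ ⟶ Z₁), IsPullback g p₁ p f ∧ Deflation S p₁

/-- A short exact sequence `0 ⟶ Y ⟶ M ⟶ X ⟶ 0` in the class `S` with fixed ends. -/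
structure Conflation (S : ObjectProperty (ShortComplex C)) (X Y : C) where
  M : C
  i : Y ⟶ M
  p : M ⟶ X
  zero : i ≫ p = 0
  mem : S (ShortComplex.mk i p zero)

/-- There is a morphism of short exact sequences inducing `a` on the right end and `b` on the left
end. -/
def Conflation.HasMor {S : ObjectProperty (ShortComplex C)} {X Y X₁ Y₁ : C}
    (c : Conflation S X Y) (d : Conflation S X₁ Y₁) (a : X ⟶ X₁) (b : Y ⟶ Y₁) : Prop :=
  ∃ m : c.M ⟶ d.M, c.i ≫ m = b ≫ d.i ∧ c.p ≫ a = m ≫ d.p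

/-- `Extension S n X Y` is the type of exact sequences
`0 ⟶ Y ⟶ M_n ⟶ ⋯ ⟶ M_0 ⟶ X ⟶ 0` with `n + 1` middle terms, that is, of `n + 1` short
exact sequences in `S` spliced together. -/
def Extension (S : ObjectProperty (ShortComplex C)) : ℕ → C → C → Type (max u v)
  | 0, X, Y => Conflation S X Y
  | n + 1, X, Y => Σ K : C, Conflation S K Y × Extension S n X K

/-- There is a morphism of exact sequences inducing `a` on the right end and `b` on the left end. -/
def Extension.HasMor (S : ObjectProperty (ShortComplex C)) :
    (n : ℕ) → {X Y X₁ Y₁ : C} → Extension S n X Y → Extension S n X₁ Y₁ →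
      (X ⟶ X₁) → (Y ⟶ Y₁) → Prop
  | 0, _, _, _, _, c, d, a, b => Conflation.HasMor (S := S) c d a b
  | n + 1, _, _, _, _, e, f, a, b =>
      ∃ k : e.1 ⟶ f.1, e.2.1.HasMor f.2.1 k b ∧ Extension.HasMor S n e.2.2 f.2.2 a k

/-- `ExtSucc S n X Y` is the Yoneda extension group `Ext^{n+1}(X, Y)` (as a set): exact sequences
from `Y` to `X` with `n + 1` middle terms, modulo the equivalence relation generated by morphisms
of exact sequences that are the identity on both ends. -/
def ExtSucc (S : ObjectProperty (ShortComplex C)) (n : ℕ) (X Y : C) : Type (max u v) :=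
  Quot (fun e f : Extension S n X Y => Extension.HasMor S n e f (𝟙 X) (𝟙 Y))

/-- The right perpendicular category `𝒯^⊥`: all `M` with `Ext^i(X, M) = 0` for all `i ≥ 1` and all
`X` in `𝒯`. (The set `Ext^i(X, M)` always contains the zero class, so it vanishes if and only if
it has at most one element.) -/
def perp (S : ObjectProperty (ShortComplex C)) (𝒯 : ObjectProperty C) : ObjectProperty C :=
  fun M => ∀ X : C, 𝒯 X → ∀ n : ℕ, Subsingleton (ExtSucc S n X M)

/-- `𝒯` is self-orthogonal: `Ext^i(X, Y) = 0` for all `i ≥ 1` and `X`, `Y` in `𝒯`. -/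
def SelfOrthogonal (S : ObjectProperty (ShortComplex C)) (𝒯 : ObjectProperty C) : Prop :=
  𝒯 ≤ perp S 𝒯

/-- The class of short exact sequences of the full subcategory `𝒳`: those short exact
sequences in `S` with all three terms in `𝒳`. -/
def restrict (S : ObjectProperty (ShortComplex C)) (𝒳 : ObjectProperty C) :
    ObjectProperty (ShortComplex 𝒳.FullSubcategory) :=
  fun E => S (E.map 𝒳.ι)

/-- `P` is projective: morphisms from `P` lift along deflations. -/
def IsProj (S : ObjectProperty (ShortComplex C)) (P : C) : Prop :=
  ∀ {B Z : C} (p : B ⟶ Z), Deflation S p → ∀ f : P ⟶ Z, ∃ g : P ⟶ B, g ≫ p = f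

/-- Every object is the target of a deflation from a projective object. -/
def EnoughProj (S : ObjectProperty (ShortComplex C)) : Prop :=
  ∀ X : C, ∃ (P : C) (p : P ⟶ X), IsProj S P ∧ Deflation S p

/-- `Cores S 𝒳 n` consists of all `M` with an exact sequence
`0 ⟶ M ⟶ X_0 ⟶ ⋯ ⟶ X_n ⟶ 0` with all `X_i` in `𝒳`. -/
def Cores (S : ObjectProperty (ShortComplex C)) (𝒳 : ObjectProperty C) : ℕ → ObjectProperty C
  | 0 => fun M => ∃ X : C, 𝒳 X ∧ Nonempty (M ≅ X)
  | n + 1 => fun M => ∃ (X Z : C) (i : M ⟶ X) (p : X ⟶ Z) (w : i ≫ p = 0),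
      𝒳 X ∧ S (ShortComplex.mk i p w) ∧ Cores S 𝒳 n Z

/-- `Res S 𝒳 n` consists of all `M` with an exact sequence
`0 ⟶ X_n ⟶ ⋯ ⟶ X_0 ⟶ M ⟶ 0` with all `X_i` in `𝒳`. -/
def Res (S : ObjectProperty (ShortComplex C)) (𝒳 : ObjectProperty C) : ℕ → ObjectProperty C
  | 0 => fun M => ∃ X : C, 𝒳 X ∧ Nonempty (X ≅ M)
  | n + 1 => fun M => ∃ (Z X : C) (i : Z ⟶ X) (p : X ⟶ M) (w : i ≫ p = 0),
      𝒳 X ∧ S (ShortComplex.mk i p w) ∧ Res S 𝒳 n Z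

/-- `𝒳` is coresolving: closed under extensions and under cokernels of inflations, and every
object admits an inflation into an object of `𝒳`. -/
structure IsCoresolving (S : ObjectProperty (ShortComplex C)) (𝒳 : ObjectProperty C) : Prop where
  ext_closed : ∀ E : ShortComplex C, S E → 𝒳 E.X₁ → 𝒳 E.X₃ → 𝒳 E.X₂
  inflation_closed : ∀ E : ShortComplex C, S E → 𝒳 E.X₁ → 𝒳 E.X₂ → 𝒳 E.X₃
  copres : ∀ M : C, ∃ (X : C) (i : M ⟶ X), 𝒳 X ∧ Inflation S i

/-- `𝒳` is finitely coresolving: it is coresolving and every object has a finite coresolution by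
objects of `𝒳`. -/
def IsFinitelyCoresolving (S : ObjectProperty (ShortComplex C)) (𝒳 : ObjectProperty C) : Prop :=
  IsCoresolving S 𝒳 ∧ ∀ M : C, ∃ n : ℕ, 1 ≤ n ∧ Cores S 𝒳 n M

/-- `𝒯` is a tilting subcategory: `𝒯` is self-orthogonal, the fully exact subcategory `𝒯^⊥` has
enough projectives and its projective objects are the objects of `𝒯`, and `𝒯^⊥` is finitely
coresolving. -/
structure IsTilting (S : ObjectProperty (ShortComplex C)) (𝒯 : ObjectProperty C) : Prop where
  selfOrthogonal : SelfOrthogonal S 𝒯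
  enoughProj : EnoughProj (restrict S (perp S 𝒯))
  isProj_iff : ∀ X : (perp S 𝒯).FullSubcategory, IsProj (restrict S (perp S 𝒯)) X ↔ 𝒯 X.obj
  finitelyCoresolving : IsFinitelyCoresolving S (perp S 𝒯)

/-- `𝒯` is `n`-tilting: it is tilting and every object has a coresolution
`0 ⟶ M ⟶ X_0 ⟶ ⋯ ⟶ X_n ⟶ 0` with all `X_i` in `𝒯^⊥`. -/
def IsNTilting (S : ObjectProperty (ShortComplex C)) (n : ℕ) (𝒯 : ObjectProperty C) : Prop :=
  IsTilting S 𝒯 ∧ ∀ M : C, Cores S (perp S 𝒯) n M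

/-- The objects of `𝒯` viewed in the full subcategory `𝒳`. -/
def inside (𝒳 𝒯 : ObjectProperty C) : ObjectProperty 𝒳.FullSubcategory :=
  fun X => 𝒯 X.obj

/-- `𝒯` is an `m`-tilting subcategory of the fully exact subcategory `𝒳`. -/
def IsNTiltingIn (S : ObjectProperty (ShortComplex C)) (𝒳 : ObjectProperty C) (m : ℕ)
    (𝒯 : ObjectProperty C) : Prop :=
  𝒯 ≤ 𝒳 ∧ IsNTilting (restrict S 𝒳) m (inside 𝒳 𝒯)

/-- `Cores_m(𝒯)` formed in the fully exact subcategory `𝒳`, as a subcategory of `C`. -/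
def CoresIn (S : ObjectProperty (ShortComplex C)) (𝒳 : ObjectProperty C) (m : ℕ)
    (𝒯 : ObjectProperty C) : ObjectProperty C :=
  fun X => ∃ h : 𝒳 X, Cores (restrict S 𝒳) (inside 𝒳 𝒯) m ⟨X, h⟩

/-- `Res_m(𝒯)` formed in the fully exact subcategory `𝒳`, as a subcategory of `C`. -/
def ResIn (S : ObjectProperty (ShortComplex C)) (𝒳 : ObjectProperty C) (m : ℕ)
    (𝒯 : ObjectProperty C) : ObjectProperty C :=
  fun X => ∃ h : 𝒳 X, Res (restrict S 𝒳) (inside 𝒳 𝒯) m ⟨X, h⟩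

/-- `𝒯` is closed under direct summands (in particular under isomorphisms). -/
def ClosedUnderSummands [HasBinaryBiproducts C] (𝒯 : ObjectProperty C) : Prop :=
  ∀ X Y Z : C, Nonempty (Z ≅ X ⊞ Y) → 𝒯 Z → 𝒯 X

/-- `𝒯` is an additive subcategory: it contains the zero objects and is closed under finite
direct sums (in particular under isomorphisms). -/
structure IsAdditive [HasBinaryBiproducts C] (𝒯 : ObjectProperty C) : Prop where
  zero_mem : ∀ Z : C, IsZero Z → 𝒯 Z
  sum_mem : ∀ X Y Z : C, 𝒯 X → 𝒯 Y → Nonempty (Z ≅ X ⊞ Y) → 𝒯 Z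

/-- The relation `𝒰 ≤ 𝒯`: `𝒰` is `m`-tilting for some `m`, and `𝒰^⊥ ⊆ 𝒯^⊥`. -/
def TiltLE (S : ObjectProperty (ShortComplex C)) (𝒰 𝒯 : ObjectProperty C) : Prop :=
  (∃ m : ℕ, IsNTilting S m 𝒰) ∧ perp S 𝒰 ≤ perp S 𝒯

end ExactCat

/-!
The proof is dimension shifting, so it needs the long exact sequences of Yoneda `Ext` in both
variables, without enough projectives or injectives.

*Extension groups.* The right satellite `sat F` of an additive functor `F : C ⥤ Ab` has as value at
`Y` the direct limit of the cokernels of `F M ⟶ F K` over all conflations `Y ⟶ M ⟶ K`, and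
`extFun X n` is the `n`-th satellite of `Hom(X, -)`. An exact sequence, read from left to right as
a splice of conflations, has a class in `extFun X (n + 1)`, and Yoneda's `Ext^{n+1}(X, Y)` vanishes
if and only if `extFun X (n + 1)` vanishes at `Y` (`extVanish_iff`). Exactness in the second
variable holds for the satellite of any half exact functor. For the first variable one uses that
satellites preserve exactness in the middle of `F ⟶ G ⟶ H` when the cokernel of `G ⟶ H` is
effaceable (`StablyExact.sat`), starting from `Hom(D, -) ⟶ Hom(B, -) ⟶ Hom(A, -) ⟶
Ext^1(D, -) ⟶ Ext^1(B, -)`. Only the consequences for vanishing are needed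
(`ExtVanish.right_middle` and its five companions).

*Tilting.* Objects of an `n`-tilting subcategory `𝒯` have projective dimension at most `n`.
If `𝒰` is tilting and contained in `𝒯^⊥`, shifting along `𝒰`-resolutions of objects of `𝒰^⊥` gives
`𝒰^⊥ ⊆ 𝒯^⊥` (`perp_le_of_le_perp`). In that case an approximation argument in the style of
Auslander and Buchweitz (`IsTilting.exists_approximation`) embeds each `T` in `𝒯` into an object
of `𝒰` with cokernel finitely coresolved by `𝒰`, while objects of `𝒰` have finite `𝒯`-resolutions
because they have finite projective dimension.

Conversely, given such resolutions and coresolutions, the essential point is that an object `X` of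
`𝒯^⊥` embeds into `𝒰^⊥` (`exists_embedding_of_res`): a `𝒯`-resolution of `X` is turned step by step
into a conflation `X ⟶ B ⟶ D` where `D` has a finite coresolution by `𝒰` and `B` has a
`𝒰`-resolution so long that the finite projective dimension of `𝒰` forces `B` into `𝒰^⊥`. If `X`
is already in `𝒰^⊥` this conflation splits, and `X` becomes a quotient of an object of `𝒰`. The
resulting criterion `isNTilting_of_cores` is applied both in the given category and in the fully
exact subcategory `𝒯^⊥`; the two notions of `Ext` agree there because objects of `𝒯` are acyclic
for both (`extVanish_restrict_iff`). Finally, a tilting subcategory consists of the projective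
objects of its perpendicular category, which gives antisymmetry and the last assertion.
-/

namespace ExactCat

/-! ### Elementary properties of exact structures -/

section Conflations

variable {C : Type u} [Category.{v} C] [Preadditive C]

/-- `A ⟶ B ⟶ D` is a short exact sequence of `S`. -/
def IsConf (S : ObjectProperty (ShortComplex C)) {A B D : C} (i : A ⟶ B) (p : B ⟶ D) : Prop :=
  ∃ w : i ≫ p = 0, S (ShortComplex.mk i p w)

variable {S : ObjectProperty (ShortComplex C)}

lemma Conflation.isConf {X Y : C} (c : Conflation S X Y) : IsConf S c.i c.p := ⟨c.zero, c.mem⟩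

/-- The conflation with prescribed maps. -/
def IsConf.conf {A B D : C} {i : A ⟶ B} {p : B ⟶ D} (h : IsConf S i p) : Conflation S D A :=
  ⟨B, i, p, h.1, h.2⟩

lemma IsConf.w {A B D : C} {i : A ⟶ B} {p : B ⟶ D} (h : IsConf S i p) : i ≫ p = 0 := h.1

variable (hS : IsExactStructure S)

include hS

lemma IsConf.lift {A B D : C} {i : A ⟶ B} {p : B ⟶ D} (h : IsConf S i p) {X : C} (f : X ⟶ B)
    (hf : f ≫ p = 0) : ∃ g : X ⟶ A, g ≫ i = f := by
  obtain ⟨l⟩ := hS.isKernel _ h.2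
  exact ⟨_, (KernelFork.IsLimit.lift' l f hf).2⟩

lemma IsConf.desc {A B D : C} {i : A ⟶ B} {p : B ⟶ D} (h : IsConf S i p) {X : C} (f : B ⟶ X)
    (hf : i ≫ f = 0) : ∃ g : D ⟶ X, p ≫ g = f := by
  obtain ⟨l⟩ := hS.isCokernel _ h.2
  exact ⟨_, (CokernelCofork.IsColimit.desc' l f hf).2⟩

lemma IsConf.mono {A B D : C} {i : A ⟶ B} {p : B ⟶ D} (h : IsConf S i p) : Mono i := by
  obtain ⟨l⟩ := hS.isKernel _ h.2
  exact ⟨fun _ _ e => Fork.IsLimit.hom_ext l e⟩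

lemma IsConf.epi {A B D : C} {i : A ⟶ B} {p : B ⟶ D} (h : IsConf S i p) : Epi p := by
  obtain ⟨l⟩ := hS.isCokernel _ h.2
  exact ⟨fun _ _ e => Cofork.IsColimit.hom_ext l e⟩

lemma IsConf.of_iso {A B D A' B' D' : C} {i : A ⟶ B} {p : B ⟶ D} (h : IsConf S i p)
    {i' : A' ⟶ B'} {p' : B' ⟶ D'} (a : A ≅ A') (b : B ≅ B') (d : D ≅ D')
    (h₁ : a.hom ≫ i' = i ≫ b.hom) (h₂ : b.hom ≫ p' = p ≫ d.hom) : IsConf S i' p' := by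
  have w : i' ≫ p' = 0 := by
    rw [← cancel_epi a.hom, ← Category.assoc, h₁, Category.assoc, h₂, ← Category.assoc, h.w]
    simp
  exact ⟨w, hS.of_iso ⟨ShortComplex.isoMk a b d h₁ h₂⟩ h.2⟩

/-- An inflation forms a conflation with each of its cokernels. -/
lemma IsConf.of_cokernel {A B D D' : C} {i : A ⟶ B} {p : B ⟶ D} (h : IsConf S i p) {p' : B ⟶ D'}
    (w : i ≫ p' = 0) [Epi p'] (s : D' ⟶ D) (hs : p' ≫ s = p) : IsConf S i p' := by
  obtain ⟨t, ht⟩ := h.desc hS p' w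
  have := h.epi hS
  refine h.of_iso hS (Iso.refl _) (Iso.refl _) ⟨t, s, ?_, ?_⟩ (by simp) (by simp [ht])
  · rw [← cancel_epi p, ← Category.assoc, ht, hs, Category.comp_id]
  · rw [← cancel_epi p', ← Category.assoc, hs, ht, Category.comp_id]

/-- A deflation forms a conflation with each of its kernels. -/
lemma IsConf.of_kernel {A B D A' : C} {i : A ⟶ B} {p : B ⟶ D} (h : IsConf S i p) {i' : A' ⟶ B}
    (w : i' ≫ p = 0) [Mono i'] (s : A ⟶ A') (hs : s ≫ i' = i) : IsConf S i' p := by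
  obtain ⟨t, ht⟩ := h.lift hS i' w
  have := h.mono hS
  refine h.of_iso hS ⟨s, t, ?_, ?_⟩ (Iso.refl _) (Iso.refl _) (by simp [hs]) (by simp)
  · rw [← cancel_mono i, Category.assoc, ht, hs, Category.id_comp]
  · rw [← cancel_mono i', Category.assoc, hs, ht, Category.id_comp]

lemma IsConf.of_isPushout {A B D A₁ B₁ : C} {i : A ⟶ B} {p : B ⟶ D} (h : IsConf S i p)
    {f : A ⟶ A₁} {g : B ⟶ B₁} {i₁ : A₁ ⟶ B₁} (sq : IsPushout i f g i₁) :
    ∃ p₁ : B₁ ⟶ D, IsConf S i₁ p₁ ∧ g ≫ p₁ = p := by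
  have hi₁ : Inflation S i₁ := by
    obtain ⟨B₂, g₂, i₂, sq₂, Z, q, hq⟩ := hS.pushout i f ⟨_, p, h⟩
    let e := sq₂.isoIsPushout _ _ sq
    refine ⟨Z, e.inv ≫ q, ?_⟩
    exact IsConf.of_iso (i := i₂) (p := q) hS hq (Iso.refl _) e (Iso.refl _)
      (by simp [e]) (by simp)
  obtain ⟨Z, q, hq⟩ := hi₁
  have hq : IsConf S i₁ q := hq
  have hp₁ : i ≫ p = f ≫ (0 : A₁ ⟶ D) := by simp [h.w]
  have := h.epi hS
  have : Epi (sq.desc p 0 hp₁) :=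
    ⟨fun a b e => by
      rw [← cancel_epi p, ← sq.inl_desc p 0 hp₁, Category.assoc, e, Category.assoc]⟩
  obtain ⟨s, hs⟩ := h.desc hS (g ≫ q)
    (by rw [← Category.assoc, sq.w, Category.assoc, hq.w, comp_zero])
  refine ⟨sq.desc p 0 hp₁, hq.of_cokernel hS (by simp) s ?_, by simp⟩
  apply sq.hom_ext
  · simp [hs]
  · simp [hq.w]

lemma IsConf.of_isPullback {A B D B₁ D₁ : C} {i : A ⟶ B} {p : B ⟶ D} (h : IsConf S i p)
    {f : D₁ ⟶ D} {g : B₁ ⟶ B} {p₁ : B₁ ⟶ D₁} (sq : IsPullback g p₁ p f) :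
    ∃ i₁ : A ⟶ B₁, IsConf S i₁ p₁ ∧ i₁ ≫ g = i := by
  have hp₁ : Deflation S p₁ := by
    obtain ⟨B₂, g₂, p₂, sq₂, Z, q, hq⟩ := hS.pullback p f ⟨_, i, h⟩
    let e := sq₂.isoIsPullback _ _ sq
    refine ⟨Z, q ≫ e.hom, ?_⟩
    exact IsConf.of_iso (i := q) (p := p₂) hS hq (Iso.refl _) e (Iso.refl _)
      (by simp) (by simp [e])
  obtain ⟨Z, q, hq⟩ := hp₁
  have hq : IsConf S q p₁ := hq
  have hi₁ : i ≫ p = (0 : A ⟶ D₁) ≫ f := by simp [h.w]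
  have := h.mono hS
  have : Mono (sq.lift i 0 hi₁) :=
    ⟨fun a b e => by
      rw [← cancel_mono i, ← sq.lift_fst i 0 hi₁, ← Category.assoc, e, Category.assoc]⟩
  obtain ⟨s, hs⟩ := h.lift hS (q ≫ g)
    (by rw [Category.assoc, sq.w, ← Category.assoc, hq.w, zero_comp])
  refine ⟨sq.lift i 0 hi₁, hq.of_kernel hS (by simp) s ?_, by simp⟩
  apply sq.hom_ext
  · simp [hs]
  · simp [hq.w]

/-- Pushout of a conflation along a morphism from its left end. -/
lemma IsConf.pushout {A B D A₁ : C} {i : A ⟶ B} {p : B ⟶ D} (h : IsConf S i p) (f : A ⟶ A₁) :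
    ∃ (B₁ : C) (g : B ⟶ B₁) (i₁ : A₁ ⟶ B₁) (p₁ : B₁ ⟶ D),
      IsPushout i f g i₁ ∧ IsConf S i₁ p₁ ∧ g ≫ p₁ = p := by
  obtain ⟨B₁, g, i₁, sq, -⟩ := hS.pushout i f ⟨_, p, h⟩
  obtain ⟨p₁, h₁, h₂⟩ := h.of_isPushout hS sq
  exact ⟨B₁, g, i₁, p₁, sq, h₁, h₂⟩

/-- Pullback of a conflation along a morphism to its right end. -/
lemma IsConf.pullback {A B D D₁ : C} {i : A ⟶ B} {p : B ⟶ D} (h : IsConf S i p) (f : D₁ ⟶ D) :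
    ∃ (B₁ : C) (g : B₁ ⟶ B) (i₁ : A ⟶ B₁) (p₁ : B₁ ⟶ D₁),
      IsPullback g p₁ p f ∧ IsConf S i₁ p₁ ∧ i₁ ≫ g = i := by
  obtain ⟨B₁, g, p₁, sq, -⟩ := hS.pullback p f ⟨_, i, h⟩
  obtain ⟨i₁, h₁, h₂⟩ := h.of_isPullback hS sq
  exact ⟨B₁, g, i₁, p₁, sq, h₁, h₂⟩

/-- The pushout of two conflations with the same left end. -/
lemma IsConf.pushout_pushout {A B D B' D' : C} {i : A ⟶ B} {p : B ⟶ D} {i' : A ⟶ B'} {p' : B' ⟶ D'}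
    (h : IsConf S i p) (h' : IsConf S i' p') :
    ∃ (P : C) (j : B ⟶ P) (q : P ⟶ D') (j' : B' ⟶ P) (q' : P ⟶ D),
      IsConf S j q ∧ IsConf S j' q' ∧ i ≫ j = i' ≫ j' ∧ j ≫ q' = p ∧ j' ≫ q = p' := by
  obtain ⟨P, j, j', q', sq, h₁, h₂⟩ := h.pushout hS i'
  obtain ⟨q, h₃, h₄⟩ := h'.of_isPushout hS sq.flip
  exact ⟨P, j, q, j', q', h₃, h₁, sq.w, h₂, h₄⟩

/-- The pullback of two conflations with the same right end. -/
lemma IsConf.pullback_pullback {A B D A' B' : C} {i : A ⟶ B} {p : B ⟶ D} {i' : A' ⟶ B'}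
    {p' : B' ⟶ D} (h : IsConf S i p) (h' : IsConf S i' p') :
    ∃ (P : C) (j : A ⟶ P) (q : P ⟶ B') (j' : A' ⟶ P) (q' : P ⟶ B),
      IsConf S j q ∧ IsConf S j' q' ∧ q' ≫ p = q ≫ p' ∧ j ≫ q' = i ∧ j' ≫ q = i' := by
  obtain ⟨P, q', j, q, sq, h₁, h₂⟩ := h.pullback hS p'
  obtain ⟨j', h₃, h₄⟩ := h'.of_isPullback hS sq.flip
  exact ⟨P, j, q, j', q', h₁, h₃, sq.w, h₂, h₄⟩

/-- The third isomorphism theorem: for inflations `A ⟶ B ⟶ E` there is a short exact sequence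
`B/A ⟶ E/A ⟶ E/B`. -/
lemma IsConf.comp_inflation {A B D E F : C} {i : A ⟶ B} {p : B ⟶ D} (h : IsConf S i p)
    {j : B ⟶ E} {q : E ⟶ F} (h' : IsConf S j q) :
    ∃ (P : C) (r : E ⟶ P) (k : D ⟶ P) (s : P ⟶ F),
      IsConf S (i ≫ j) r ∧ IsConf S k s ∧ p ≫ k = j ≫ r ∧ r ≫ s = q := by
  obtain ⟨P, r, k, s, sq, h₁, h₂⟩ := h'.pushout hS p
  refine ⟨P, r, k, s, ?_, h₁, sq.w.symm, h₂⟩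
  obtain ⟨Z, t, ht⟩ := hS.inflation_comp i j ⟨_, p, h⟩ ⟨_, q, h'⟩
  have ht : IsConf S (i ≫ j) t := ht
  have := h.epi hS
  have : Epi r := sq.epi_inl_of_epi
  obtain ⟨d, hd⟩ := h.desc hS (j ≫ t) (by rw [← Category.assoc, ht.w])
  exact ht.of_cokernel hS (by rw [Category.assoc, sq.w, ← Category.assoc, h.w, zero_comp])
    (sq.desc t d hd.symm) (by simp)

/-- The kernel of a composite of two deflations is an extension of their kernels. -/
lemma IsConf.comp_deflation {A B D E F : C} {i : A ⟶ B} {p : B ⟶ D} (h : IsConf S i p)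
    {j : E ⟶ D} {q : D ⟶ F} (h' : IsConf S j q) :
    ∃ (P : C) (r : P ⟶ B) (k : A ⟶ P) (s : P ⟶ E),
      IsConf S r (p ≫ q) ∧ IsConf S k s ∧ r ≫ p = s ≫ j ∧ k ≫ r = i := by
  obtain ⟨P, r, k, s, sq, h₁, h₂⟩ := h.pullback hS j
  refine ⟨P, r, k, s, ?_, h₁, sq.w, h₂⟩
  obtain ⟨Z, t, ht⟩ := hS.deflation_comp p q ⟨_, i, h⟩ ⟨_, j, h'⟩
  have ht : IsConf S t (p ≫ q) := ht
  have := h'.mono hS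
  have : Mono r := sq.mono_fst_of_mono
  obtain ⟨d, hd⟩ := h'.lift hS (t ≫ p) (by rw [Category.assoc, ht.w])
  exact ht.of_kernel hS (by rw [← Category.assoc, sq.w, Category.assoc, h'.w, comp_zero])
    (sq.lift t d hd.symm) (by simp)

lemma isConf_of_isIso_of_isZero {A B Z : C} (i : A ⟶ B) [IsIso i] (hZ : IsZero Z) (p : B ⟶ Z) :
    IsConf S i p := by
  obtain ⟨Z', q, hq⟩ := hS.inflation_id A
  have hq : IsConf S (𝟙 A) q := hq
  have hz : IsZero Z' := by
    have := hq.epi hS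
    rw [IsZero.iff_id_eq_zero, ← cancel_epi q, ← Category.id_comp q, hq.w]
    simp
  exact hq.of_iso hS (Iso.refl _) (asIso i) (hz.iso hZ) (by simp) (hZ.eq_of_tgt _ _)

lemma isConf_of_isZero_of_isIso {A B Z : C} (i : Z ⟶ A) (hZ : IsZero Z) (p : A ⟶ B) [IsIso p] :
    IsConf S i p := by
  obtain ⟨Z', q, hq⟩ := hS.deflation_id A
  have hq : IsConf S q (𝟙 A) := hq
  have hz : IsZero Z' := by
    have := hq.mono hS
    rw [IsZero.iff_id_eq_zero, ← cancel_mono q, ← Category.comp_id q, hq.w]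
    simp
  exact hq.of_iso hS (hz.iso hZ) (Iso.refl _) (asIso p) (hz.eq_of_src _ _) (by simp)

/-- A morphism of conflations that is the identity on both ends is an isomorphism. -/
lemma IsConf.isIso_of_mor {A B D B' : C} {i : A ⟶ B} {p : B ⟶ D} {i' : A ⟶ B'} {p' : B' ⟶ D}
    (h : IsConf S i p) (h' : IsConf S i' p') (u : B ⟶ B') (h₁ : i ≫ u = i') (h₂ : u ≫ p' = p) :
    IsIso u := by
  obtain ⟨Q, j, q, j', q', hj, hj', hw, hi, hi'⟩ := h.pullback_pullback hS h'
  have := h.mono hS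
  have := h'.mono hS
  have := hj.epi hS
  -- on "elements" `(b, x)` of the pullback `Q`, the inverse of `u` sends `x` to `b + (x - u b)`
  obtain ⟨r, hr⟩ := h'.lift hS (q - q' ≫ u) (by simp [h₂, hw])
  have hjr : j ≫ r = -𝟙 A := by
    rw [← cancel_mono i', Category.assoc, hr, Preadditive.comp_sub, hj.w, ← Category.assoc, hi, h₁]
    simp
  obtain ⟨v, hv⟩ := hj.desc hS (q' + r ≫ i) (by
    rw [Preadditive.comp_add, hi, ← Category.assoc, hjr]; simp)
  have hvu : v ≫ u = 𝟙 _ := by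
    rw [← cancel_epi q, ← Category.assoc, hv, Preadditive.add_comp, Category.assoc, h₁, hr]
    simp
  have hmono : Mono u := by
    refine Preadditive.mono_of_cancel_zero _ fun f hf => ?_
    obtain ⟨g, rfl⟩ := h.lift hS f (by rw [← h₂, ← Category.assoc, hf, zero_comp])
    rw [Category.assoc, h₁] at hf
    rw [(cancel_mono i').1 (hf.trans zero_comp.symm), zero_comp]
  exact ⟨v, by rw [← cancel_mono u, Category.assoc, hvu]; simp, hvu⟩

/-- The right square of a morphism of conflations that is the identity on the left ends is a
pullback. -/
lemma IsConf.isPullback_of_mor {A B D B' D' : C} {i : A ⟶ B} {p : B ⟶ D} {i' : A ⟶ B'}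
    {p' : B' ⟶ D'} (h : IsConf S i p) (h' : IsConf S i' p') (m : B ⟶ B') (k : D ⟶ D')
    (h₁ : i ≫ m = i') (h₂ : p ≫ k = m ≫ p') : IsPullback m p p' k := by
  obtain ⟨P, g, i₁, p₁, sq, hP, hg⟩ := h'.pullback hS k
  have : IsIso (sq.lift m p h₂.symm) := h.isIso_of_mor hS hP _ (by
    apply sq.hom_ext
    · simp [h₁, hg]
    · simp [h.w, hP.w]) (by simp)
  exact sq.of_iso (asIso (sq.lift m p h₂.symm)).symm (Iso.refl _) (Iso.refl _) (Iso.refl _)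
    (by simp) (by simp) (by simp) (by simp)

/-- A conflation whose right map has a section is split. -/
lemma IsConf.exists_retraction {A B D : C} {i : A ⟶ B} {p : B ⟶ D} (h : IsConf S i p) (s : D ⟶ B)
    (hs : s ≫ p = 𝟙 _) :
    ∃ r : B ⟶ A, i ≫ r = 𝟙 _ ∧ s ≫ r = 0 ∧ r ≫ i + p ≫ s = 𝟙 _ := by
  have := h.mono hS
  obtain ⟨r, hr⟩ := h.lift hS (𝟙 _ - p ≫ s) (by simp [hs])
  refine ⟨r, ?_, ?_, by simp [hr]⟩
  · rw [← cancel_mono i, Category.assoc, hr, Preadditive.comp_sub, ← Category.assoc, h.w]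
    simp
  · rw [← cancel_mono i, Category.assoc, hr, Preadditive.comp_sub, ← Category.assoc, hs]
    simp

section Biproducts

variable [HasBinaryBiproducts C]

open ZeroObject

lemma IsConf.iso_biprod {A B D : C} {i : A ⟶ B} {p : B ⟶ D} (h : IsConf S i p) (s : D ⟶ B)
    (hs : s ≫ p = 𝟙 _) : Nonempty (B ≅ A ⊞ D) := by
  obtain ⟨r, hr, hsr, hadd⟩ := h.exists_retraction hS s hs
  have := h.w
  exact ⟨⟨biprod.lift r p, biprod.desc i s, by simp [hadd], by ext <;> simp [*]⟩⟩

variable [HasZeroObject C]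

lemma isConf_inl_snd (A D : C) : IsConf S (biprod.inl : A ⟶ A ⊞ D) biprod.snd := by
  have h := isConf_of_isIso_of_isZero hS (𝟙 A) (isZero_zero C) 0
  obtain ⟨i, hi, hi'⟩ := h.of_isPullback hS (IsPullback.of_has_biproduct A D)
  have : i = biprod.inl := by ext <;> simp [hi.w, hi']
  exact this ▸ hi

lemma isConf_of_split {A B D : C} {i : A ⟶ B} {p : B ⟶ D} (r : B ⟶ A) (s : D ⟶ B)
    (hir : i ≫ r = 𝟙 _) (hsp : s ≫ p = 𝟙 _) (hsr : s ≫ r = 0) (hip : i ≫ p = 0)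
    (hadd : r ≫ i + p ≫ s = 𝟙 _) : IsConf S i p :=
  (isConf_inl_snd hS A D).of_iso hS (Iso.refl _)
    ⟨biprod.desc i s, biprod.lift r p, by ext <;> simp [*], by simp [*]⟩ (Iso.refl _)
    (by simp) (by ext <;> simp [*])

lemma IsConf.swap_of_section {A B D : C} {i : A ⟶ B} {p : B ⟶ D} (h : IsConf S i p) (s : D ⟶ B)
    (hs : s ≫ p = 𝟙 _) : ∃ r : B ⟶ A, i ≫ r = 𝟙 _ ∧ IsConf S s r := by
  obtain ⟨r, hr, hsr, hadd⟩ := h.exists_retraction hS s hs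
  exact ⟨r, hr, isConf_of_split hS p i hs hr h.w hsr (by rw [add_comm, hadd])⟩

/-- The short exact sequence `B ⟶ B' ⊞ D ⟶ D'` of a pullback square whose vertical maps are
deflations. -/
lemma IsConf.of_mor {A B D B' D' : C} {i : A ⟶ B} {p : B ⟶ D} {i' : A ⟶ B'}
    {p' : B' ⟶ D'} (h : IsConf S i p) (h' : IsConf S i' p') (m : B ⟶ B') (k : D ⟶ D')
    (h₁ : i ≫ m = i') (h₂ : p ≫ k = m ≫ p') :
    IsConf S (biprod.lift m p) (biprod.desc p' (-k)) := by
  have sq := h.isPullback_of_mor hS h' m k h₁ h₂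
  have sq' : IsPullback biprod.fst (biprod.map p' (𝟙 D)) p' biprod.fst :=
    IsPullback.mk' (by simp) (fun _ f g e₁ e₂ => by
        ext
        · exact e₁
        · simpa using congr($e₂ ≫ biprod.snd))
      (fun _ a b e => ⟨biprod.lift a (b ≫ biprod.snd), by simp, by ext <;> simp [e]⟩)
  obtain ⟨j, hj, -⟩ := h'.of_isPullback hS sq'
  have hk : IsConf S (biprod.lift k (𝟙 D)) (biprod.desc (𝟙 D') (-k)) :=
    isConf_of_split hS biprod.snd biprod.inl (by simp) (by simp) (by simp) (by simp)
      (by ext <;> simp)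
  obtain ⟨Z, t, ht⟩ := hS.deflation_comp _ _ ⟨_, j, hj⟩ ⟨_, _, hk⟩
  have e : biprod.map p' (𝟙 D) ≫ biprod.desc (𝟙 D') (-k) = biprod.desc p' (-k) := by
    ext <;> simp
  have ht : IsConf S t (biprod.desc p' (-k)) := e ▸ ht
  have : Mono (biprod.lift m p) := by
    refine Preadditive.mono_of_cancel_zero _ fun f hf => ?_
    apply sq.hom_ext
    · simpa using congr($hf ≫ biprod.fst)
    · simpa using congr($hf ≫ biprod.snd)
  have htw := ht.w
  rw [biprod.desc_eq, Preadditive.comp_add] at htw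
  refine ht.of_kernel hS (by simp [h₂])
    (sq.lift (t ≫ biprod.fst) (t ≫ biprod.snd) ?_) ?_
  · rw [← sub_eq_zero]
    simpa [sub_eq_add_neg] using htw
  · ext <;> simp

end Biproducts

end Conflations

/-! ### The right satellite of an additive functor -/

section Satellite

variable {C : Type u} [Category.{v} C]

lemma map_comp_app (F : C ⥤ AddCommGrpCat.{max u v}) {X Y Z : C} (f : X ⟶ Y) (g : Y ⟶ Z)
    (x : F.obj X) : F.map (f ≫ g) x = F.map g (F.map f x) := by simp

variable [Preadditive C]

lemma map_add_app (F : C ⥤ AddCommGrpCat.{max u v}) [F.Additive] {X Y : C} (f g : X ⟶ Y)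
    (x : F.obj X) : F.map (f + g) x = F.map f x + F.map g x := by
  rw [F.map_add]; rfl

lemma map_neg_app (F : C ⥤ AddCommGrpCat.{max u v}) [F.Additive] {X Y : C} (f : X ⟶ Y)
    (x : F.obj X) : F.map (-f) x = -F.map f x := by
  rw [F.map_neg]; rfl

lemma map_zero_app (F : C ⥤ AddCommGrpCat.{max u v}) [F.Additive] {X Y : C}
    (x : F.obj X) : F.map (0 : X ⟶ Y) x = 0 := by
  rw [F.map_zero]; rfl

variable {S : ObjectProperty (ShortComplex C)}

lemma Conflation.HasMor.refl {X Y : C} (c : Conflation S X Y) : c.HasMor c (𝟙 X) (𝟙 Y) :=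
  ⟨𝟙 _, by simp, by simp⟩

lemma Conflation.HasMor.trans {X Y X₁ Y₁ X₂ Y₂ : C} {c : Conflation S X Y}
    {d : Conflation S X₁ Y₁} {e : Conflation S X₂ Y₂} {a : X ⟶ X₁} {b : Y ⟶ Y₁} {a' : X₁ ⟶ X₂}
    {b' : Y₁ ⟶ Y₂} (h : c.HasMor d a b) (h' : d.HasMor e a' b') :
    c.HasMor e (a ≫ a') (b ≫ b') := by
  obtain ⟨m, h₁, h₂⟩ := h
  obtain ⟨n, h₃, h₄⟩ := h'
  exact ⟨m ≫ n, by rw [← Category.assoc, h₁, Category.assoc, h₃, Category.assoc],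
    by rw [← Category.assoc, h₂, Category.assoc, h₄, Category.assoc]⟩

/-- The conflations `Y ⟶ M ⟶ K` with fixed left end `Y`, preordered by the existence of a
morphism that is the identity on `Y`. -/
structure ConflationFrom (S : ObjectProperty (ShortComplex C)) (Y : C) where
  /-- the right end -/
  K : C
  /-- the short exact sequence -/
  conf : Conflation S K Y

instance (Y : C) : Preorder (ConflationFrom S Y) where
  le c d := ∃ k : c.1 ⟶ d.1, c.2.HasMor d.2 k (𝟙 Y)
  le_refl c := ⟨_, .refl c.2⟩
  le_trans c d e := by
    rintro ⟨k, h⟩ ⟨l, h'⟩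
    exact ⟨k ≫ l, by simpa using h.trans h'⟩

/-- The cokernel of `F M ⟶ F K`, for a conflation `Y ⟶ M ⟶ K`. -/
abbrev satTerm (F : C ⥤ AddCommGrpCat.{max u v}) {Y : C} (c : ConflationFrom S Y) :
    Type (max u v) :=
  F.obj c.1 ⧸ (F.map c.2.p).hom.range

/-- The transition map between the cokernels. By `satTrans_mk` it does not depend on the chosen
morphism of conflations. -/
noncomputable def satTrans (F : C ⥤ AddCommGrpCat.{max u v}) {Y : C} (c d : ConflationFrom S Y)
    (h : c ≤ d) : satTerm F c →+ satTerm F d :=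
  QuotientAddGroup.map _ _ (F.map h.choose).hom (by
    obtain ⟨m, -, h₂⟩ := h.choose_spec
    rintro _ ⟨z, rfl⟩
    refine ⟨F.map m z, ?_⟩
    change F.map d.2.p (F.map m z) = F.map h.choose (F.map c.2.p z)
    rw [← map_comp_app, ← map_comp_app, h₂])

open scoped Classical in
/-- The value at `Y` of the right satellite of `F`: the direct limit of the cokernels of
`F M ⟶ F K` over all conflations `Y ⟶ M ⟶ K`. -/
def satObj (S : ObjectProperty (ShortComplex C)) (F : C ⥤ AddCommGrpCat.{max u v}) (Y : C) :
    Type (max u v) :=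
  AddCommGroup.DirectLimit (satTerm F) (satTrans (S := S) (Y := Y) F)

open scoped Classical in
noncomputable instance (F : C ⥤ AddCommGrpCat.{max u v}) (Y : C) : AddCommGroup (satObj S F Y) :=
  inferInstanceAs (AddCommGroup (AddCommGroup.DirectLimit _ (satTrans (S := S) (Y := Y) F)))

variable (F : C ⥤ AddCommGrpCat.{max u v})

open scoped Classical in
/-- The element of the satellite represented by a conflation `Y ⟶ M ⟶ K` and an element of
`F K`. -/
noncomputable def satMk {K Y : C} (c : Conflation S K Y) : F.obj K →+ satObj S F Y :=
  (AddCommGroup.DirectLimit.of (satTerm F) (satTrans (S := S) (Y := Y) F) ⟨K, c⟩).comp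
    (QuotientAddGroup.mk' _)

lemma satMk_p {K Y : C} (c : Conflation S K Y) (z : F.obj c.M) : satMk F c (F.map c.p z) = 0 := by
  have : (QuotientAddGroup.mk (F.map c.p z) : satTerm F (⟨K, c⟩ : ConflationFrom S Y)) = 0 :=
    (QuotientAddGroup.eq_zero_iff _).2 ⟨z, rfl⟩
  classical
  exact (congrArg (AddCommGroup.DirectLimit.of (satTerm F) (satTrans (S := S) (Y := Y) F) ⟨K, c⟩)
    this).trans (map_zero _)

lemma satMk_conf_p {A B D : C} {i : A ⟶ B} {p : B ⟶ D} (h : IsConf S i p) (z : F.obj B) :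
    satMk F h.conf (F.map p z) = 0 :=
  satMk_p F h.conf z

open scoped Classical in
/-- A homomorphism out of the satellite is determined by a compatible family. -/
noncomputable def satLift {Y : C} {P : Type (max u v)} [AddCommGroup P]
    (φ : ∀ K : C, Conflation S K Y → F.obj K →+ P)
    (h₁ : ∀ ⦃K : C⦄ (c : Conflation S K Y) (z : F.obj c.M), φ _ c (F.map c.p z) = 0)
    (h₂ : ∀ ⦃K L : C⦄ (c : Conflation S K Y) (d : Conflation S L Y) (k : K ⟶ L),
      c.HasMor d k (𝟙 Y) → ∀ x, φ _ d (F.map k x) = φ _ c x) : satObj S F Y →+ P :=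
  AddCommGroup.DirectLimit.lift _ _ _
    (fun c : ConflationFrom S Y => QuotientAddGroup.lift _ (φ _ c.2) (by
      rintro _ ⟨z, rfl⟩
      exact h₁ c.2 z))
    (fun c d h x => by
      obtain ⟨x, rfl⟩ := QuotientAddGroup.mk_surjective x
      exact h₂ c.2 d.2 _ h.choose_spec x)

lemma satLift_mk {Y : C} {P : Type (max u v)} [AddCommGroup P]
    (φ : ∀ K : C, Conflation S K Y → F.obj K →+ P)
    (h₁ : ∀ ⦃K : C⦄ (c : Conflation S K Y) (z : F.obj c.M), φ _ c (F.map c.p z) = 0)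
    (h₂ : ∀ ⦃K L : C⦄ (c : Conflation S K Y) (d : Conflation S L Y) (k : K ⟶ L),
      c.HasMor d k (𝟙 Y) → ∀ x, φ _ d (F.map k x) = φ _ c x) {K : C} (c : Conflation S K Y)
    (x : F.obj K) : satLift F φ h₁ h₂ (satMk F c x) = φ _ c x := by
  classical
  exact (AddCommGroup.DirectLimit.lift_of _ _ _ _ _).trans rfl

variable (hS : IsExactStructure S)

include hS

/-- Morphisms of conflations inducing the same map on left ends differ on right ends by a map that
factors through the middle term. -/
lemma Conflation.exists_homotopy {X Y X₁ Y₁ : C} {c : Conflation S X Y}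
    {d : Conflation S X₁ Y₁} {a a' : X ⟶ X₁} {b : Y ⟶ Y₁} (h : c.HasMor d a b)
    (h' : c.HasMor d a' b) : ∃ s : X ⟶ d.M, a = a' + s ≫ d.p := by
  obtain ⟨m, h₁, h₂⟩ := h
  obtain ⟨m', h₁', h₂'⟩ := h'
  obtain ⟨s, hs⟩ := c.isConf.desc hS (m - m') (by rw [Preadditive.comp_sub, h₁, h₁', sub_self])
  have := c.isConf.epi hS
  refine ⟨s, ?_⟩
  rw [← cancel_epi c.p, Preadditive.comp_add, ← Category.assoc, hs, Preadditive.sub_comp, h₂, h₂']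
  abel

lemma satTrans_mk [F.Additive] {Y : C} {c d : ConflationFrom S Y} (h : c ≤ d) (k : c.1 ⟶ d.1)
    (hk : c.2.HasMor d.2 k (𝟙 Y)) (x : F.obj c.1) :
    satTrans F c d h (QuotientAddGroup.mk x) = QuotientAddGroup.mk (F.map k x) := by
  obtain ⟨s, hs⟩ := Conflation.exists_homotopy hS hk h.choose_spec
  change QuotientAddGroup.mk (F.map h.choose x) = _
  rw [QuotientAddGroup.eq, hs, map_add_app, map_comp_app]
  exact ⟨F.map s x, by simp⟩

lemma satMk_eq_of_hasMor [F.Additive] {K L Y : C} {c : Conflation S K Y} {d : Conflation S L Y}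
    {k : K ⟶ L} (h : c.HasMor d k (𝟙 Y)) (x : F.obj K) :
    satMk F d (F.map k x) = satMk F c x := by
  classical
  have hle : (⟨K, c⟩ : ConflationFrom S Y) ≤ ⟨L, d⟩ := ⟨k, h⟩
  have := AddCommGroup.DirectLimit.of_f (G := satTerm F) (f := satTrans (S := S) (Y := Y) F) hle
    (QuotientAddGroup.mk x)
  rw [satTrans_mk F hS hle k h] at this
  exact this

/-- Two conflations with the same left end map to a common one. -/
lemma Conflation.exists_common {K L Y : C} (c : Conflation S K Y) (d : Conflation S L Y) :
    ∃ (N : C) (e : Conflation S N Y) (k : K ⟶ N) (l : L ⟶ N),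
      c.HasMor e k (𝟙 Y) ∧ d.HasMor e l (𝟙 Y) := by
  obtain ⟨P, j, q, j', q', hj, hj', hw, h₁, h₂⟩ := c.isConf.pushout_pushout hS d.isConf
  obtain ⟨N, r, k, s, hr, -, hk, -⟩ := c.isConf.comp_inflation hS hj
  obtain ⟨l, hl⟩ := d.isConf.desc hS (j' ≫ r) (by rw [← Category.assoc, ← hw, hr.w])
  exact ⟨N, hr.conf, k, l, ⟨j, by simp [IsConf.conf], by simpa [IsConf.conf] using hk⟩,
    ⟨j', by simp [IsConf.conf, hw], by simpa [IsConf.conf] using hl⟩⟩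

lemma isDirected_conflationFrom (Y : C) : IsDirectedOrder (ConflationFrom S Y) where
  directed c d := by
    obtain ⟨N, e, k, l, h, h'⟩ := c.2.exists_common hS d.2
    exact ⟨⟨N, e⟩, ⟨k, h⟩, ⟨l, h'⟩⟩

lemma directedSystem_satTerm [F.Additive] (Y : C) :
    DirectedSystem (satTerm (S := S) (Y := Y) F) fun i j h => satTrans F i j h where
  map_self c x := by
    obtain ⟨x, rfl⟩ := QuotientAddGroup.mk_surjective x
    rw [satTrans_mk F hS le_rfl (𝟙 _) (.refl c.2)]
    simp
  map_map c d e h h' x := by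
    obtain ⟨x, rfl⟩ := QuotientAddGroup.mk_surjective x
    have := h.choose_spec.trans h'.choose_spec
    rw [Category.comp_id] at this
    rw [satTrans_mk F hS (h.trans h') _ this, satTrans_mk F hS h _ h.choose_spec,
      satTrans_mk F hS h' _ h'.choose_spec, map_comp_app]

lemma satMk_surjective {Y : C} (y : satObj S F Y) :
    ∃ (K : C) (c : Conflation S K Y) (x : F.obj K), satMk F c x = y := by
  classical
  have := isDirected_conflationFrom hS Y
  have : Nonempty (ConflationFrom S Y) := by
    obtain ⟨Z, p, w, h⟩ := hS.inflation_id Y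
    exact ⟨⟨Z, ⟨Y, 𝟙 Y, p, w, h⟩⟩⟩
  induction y using AddCommGroup.DirectLimit.induction_on with
  | ih c x =>
    obtain ⟨x, rfl⟩ := QuotientAddGroup.mk_surjective x
    exact ⟨c.1, c.2, x, rfl⟩

lemma satMk_eq_zero_iff [F.Additive] {K Y : C} (c : Conflation S K Y) (x : F.obj K) :
    satMk F c x = 0 ↔ ∃ (L : C) (d : Conflation S L Y) (k : K ⟶ L) (z : F.obj d.M),
      c.HasMor d k (𝟙 Y) ∧ F.map k x = F.map d.p z := by
  classical
  constructor
  · intro h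
    have := isDirected_conflationFrom hS Y
    have := directedSystem_satTerm F hS Y
    obtain ⟨d, hd, h0⟩ := AddCommGroup.DirectLimit.of.zero_exact (G := satTerm F)
      (f := satTrans (S := S) (Y := Y) F) ⟨K, c⟩ (QuotientAddGroup.mk x) h
    obtain ⟨k, hk⟩ := id hd
    rw [satTrans_mk F hS hd k hk, QuotientAddGroup.eq_zero_iff] at h0
    obtain ⟨z, hz⟩ := h0
    exact ⟨d.1, d.2, k, z, hk, hz.symm⟩
  · rintro ⟨L, d, k, z, h, e⟩
    rw [← satMk_eq_of_hasMor F hS h, e, satMk_p]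

lemma Conflation.exists_pushout {K Y Y' : C} (c : Conflation S K Y) (b : Y ⟶ Y') :
    ∃ c' : Conflation S K Y', c.HasMor c' (𝟙 K) b ∧
      ∀ {L : C} (d : Conflation S L Y') (k : K ⟶ L), c.HasMor d k b → c'.HasMor d k (𝟙 Y') := by
  obtain ⟨B₁, g, i₁, p₁, sq, h, hg⟩ := c.isConf.pushout hS b
  refine ⟨h.conf, ⟨g, by simpa [IsConf.conf] using sq.w, by simp [IsConf.conf, hg]⟩, ?_⟩
  rintro L d k ⟨m, h₁, h₂⟩
  refine ⟨sq.desc m d.i h₁, by simp [IsConf.conf], ?_⟩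
  apply sq.hom_ext
  · simp [IsConf.conf, ← h₂, ← hg]
  · have := h.w
    simp [IsConf.conf, d.zero, reassoc_of% this]

/-- Functoriality of the satellite. -/
noncomputable def satMap [F.Additive] {Y Y' : C} (b : Y ⟶ Y') : satObj S F Y →+ satObj S F Y' :=
  satLift F (fun _ c => satMk F (c.exists_pushout hS b).choose)
    (fun _ c z => by
      obtain ⟨⟨m, -, h⟩, -⟩ := (c.exists_pushout hS b).choose_spec
      rw [Category.comp_id] at h
      rw [h, map_comp_app, satMk_p])
    (fun _ _ c d k h x => satMk_eq_of_hasMor F hS ((c.exists_pushout hS b).choose_spec.2 _ _ (by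
      simpa using h.trans (d.exists_pushout hS b).choose_spec.1)) x)

lemma satMap_mk [F.Additive] {K L Y Y' : C} {b : Y ⟶ Y'} {c : Conflation S K Y}
    {d : Conflation S L Y'} {k : K ⟶ L} (h : c.HasMor d k b) (x : F.obj K) :
    satMap F hS b (satMk F c x) = satMk F d (F.map k x) :=
  (satLift_mk F _ _ _ c x).trans
    (satMk_eq_of_hasMor F hS ((c.exists_pushout hS b).choose_spec.2 _ _ h) x).symm

/-- The right satellite of an additive functor. -/
noncomputable def sat [F.Additive] : C ⥤ AddCommGrpCat.{max u v} where
  obj Y := AddCommGrpCat.of (satObj S F Y)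
  map b := AddCommGrpCat.ofHom (satMap F hS b)
  map_id Y := by
    ext y
    obtain ⟨K, c, x, rfl⟩ := satMk_surjective F hS y
    exact (satMap_mk F hS (.refl c) x).trans (by simp)
  map_comp b b' := by
    ext y
    obtain ⟨K, c, x, rfl⟩ := satMk_surjective F hS y
    obtain ⟨c', h', -⟩ := c.exists_pushout hS b
    obtain ⟨c'', h'', -⟩ := c'.exists_pushout hS b'
    change satMap F hS (b ≫ b') _ = satMap F hS b' (satMap F hS b _)
    rw [satMap_mk F hS h', satMap_mk F hS h'', satMap_mk F hS (h'.trans h''), map_comp_app]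

lemma sat_map_mk [F.Additive] {K L Y Y' : C} {b : Y ⟶ Y'} {c : Conflation S K Y}
    {d : Conflation S L Y'} {k : K ⟶ L} (h : c.HasMor d k b) (x : F.obj K) :
    (sat F hS).map b (satMk F c x) = satMk F d (F.map k x) :=
  satMap_mk F hS h x

instance sat_additive [F.Additive] : (sat F hS).Additive where
  map_add {Y Y' b b'} := by
    ext y
    obtain ⟨K, c, x, rfl⟩ := satMk_surjective F hS y
    obtain ⟨c', h', -⟩ := c.exists_pushout hS b
    obtain ⟨c'', h'', -⟩ := c.exists_pushout hS b'
    obtain ⟨N, e, k, l, hk, hl⟩ := c'.exists_common hS c''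
    have e₁ := h'.trans hk
    have e₂ := h''.trans hl
    have e₃ : c.HasMor e (𝟙 K ≫ k + 𝟙 K ≫ l) (b ≫ 𝟙 _ + b' ≫ 𝟙 _) := by
      obtain ⟨m, h₁, h₂⟩ := e₁
      obtain ⟨n, h₃, h₄⟩ := e₂
      exact ⟨m + n, by rw [Preadditive.comp_add, h₁, h₃, Preadditive.add_comp],
        by rw [Preadditive.comp_add, h₂, h₄, Preadditive.add_comp]⟩
    simp only [Category.id_comp, Category.comp_id] at e₁ e₂ e₃
    change (sat F hS).map (b + b') (satMk F c x) =
      (sat F hS).map b (satMk F c x) + (sat F hS).map b' (satMk F c x)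
    rw [sat_map_mk F hS e₁, sat_map_mk F hS e₂, sat_map_mk F hS e₃, map_add_app, map_add]
    rfl

end Satellite

/-! ### Exactness properties of satellites -/

section Exactness

variable {C : Type u} [Category.{v} C]

lemma naturality_app {F G : C ⥤ AddCommGrpCat.{max u v}} (α : F ⟶ G) {X Y : C} (f : X ⟶ Y)
    (x : F.obj X) : α.app Y (F.map f x) = G.map f (α.app X x) :=
  NatTrans.naturality_apply α f x

variable [Preadditive C] {S : ObjectProperty (ShortComplex C)}

/-- `F` sends a short exact sequence to a sequence that is exact in the middle. -/
def HalfExact (S : ObjectProperty (ShortComplex C)) (F : C ⥤ AddCommGrpCat.{max u v}) : Prop :=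
  ∀ ⦃A B D : C⦄ (i : A ⟶ B) (p : B ⟶ D), IsConf S i p →
    ∀ x : F.obj B, F.map p x = 0 → ∃ y, F.map i y = x

/-- The sequence `F ⟶ G ⟶ H` of functors is exact in the middle (`ker β ⊆ im α`), and every
element of `H` comes from `G` after applying an inflation (the cokernel of `β` is effaceable). The
second condition makes the property stable under passing to satellites. -/
structure StablyExact (S : ObjectProperty (ShortComplex C)) {F G H : C ⥤ AddCommGrpCat.{max u v}}
    (α : F ⟶ G) (β : G ⟶ H) : Prop where
  exact : ∀ (Y : C) (g : G.obj Y), β.app Y g = 0 → ∃ f, α.app Y f = g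
  effaceable : ∀ (Y : C) (h : H.obj Y), ∃ (M K : C) (i : Y ⟶ M) (p : M ⟶ K),
    IsConf S i p ∧ ∃ g, H.map i h = β.app M g

/-- The components of `satNat`. -/
noncomputable def satNatApp (hS : IsExactStructure S)
    {F G : C ⥤ AddCommGrpCat.{max u v}} [G.Additive] (α : F ⟶ G) (Y : C) :
    satObj S F Y →+ satObj S G Y :=
  satLift F (fun K c => (satMk G c).comp (α.app K).hom)
    (fun K c z => by
      change satMk G c (α.app K (F.map c.p z)) = 0
      rw [naturality_app, satMk_p])
    (fun K L c d k h x => by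
      change satMk G d (α.app L (F.map k x)) = satMk G c (α.app K x)
      rw [naturality_app, satMk_eq_of_hasMor G hS h])

lemma satNatApp_mk (hS : IsExactStructure S)
    {F G : C ⥤ AddCommGrpCat.{max u v}} [G.Additive] (α : F ⟶ G) {K Y : C}
    (c : Conflation S K Y) (x : F.obj K) :
    satNatApp hS α Y (satMk F c x) = satMk G c (α.app K x) :=
  satLift_mk F _ _ _ c x

variable (F : C ⥤ AddCommGrpCat.{max u v}) [F.Additive] (hS : IsExactStructure S)

/-- Satellites are effaceable: every element vanishes after applying an inflation. -/
lemma sat_effaceable {Y : C} (y : (sat F hS).obj Y) :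
    ∃ (M K : C) (i : Y ⟶ M) (p : M ⟶ K), IsConf S i p ∧ (sat F hS).map i y = 0 := by
  obtain ⟨K, c, x, rfl⟩ := satMk_surjective F hS y
  obtain ⟨Z, q, w, hq⟩ := hS.inflation_id c.M
  refine ⟨_, _, c.i, c.p, c.isConf, ?_⟩
  have h : c.HasMor ⟨c.M, 𝟙 c.M, q, w, hq⟩ 0 c.i :=
    ⟨𝟙 _, by simp, by
      have : q = 0 := by simpa using w
      simp [this]⟩
  rw [sat_map_mk F hS h, map_zero_app, map_zero]
  rfl

lemma sat_eq_zero (hF : ∀ (Y : C) (x : F.obj Y), x = 0) (Y : C) (y : (sat F hS).obj Y) :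
    y = 0 := by
  obtain ⟨K, c, x, rfl⟩ := satMk_surjective F hS y
  rw [hF _ x, map_zero]
  rfl

include hS

/-- Exactness of `F B ⟶ F D ⟶ sat F A` at `F D`. -/
lemma HalfExact.exists_of_satMk_eq_zero [HasZeroObject C] [HasBinaryBiproducts C]
    (hF : HalfExact S F) {A D : C} (c : Conflation S D A) (x : F.obj D)
    (hx : satMk F c x = 0) : ∃ w, F.map c.p w = x := by
  obtain ⟨L, d, k, z, ⟨m, h₁, h₂⟩, e⟩ := (satMk_eq_zero_iff F hS c x).1 hx
  have hc := c.isConf.of_mor hS d.isConf m k (by simpa using h₁) h₂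
  obtain ⟨y, hy⟩ := hF _ _ hc (F.map biprod.inl z + F.map biprod.inr x) (by
    rw [map_add, ← map_comp_app, ← map_comp_app, biprod.inl_desc, biprod.inr_desc, map_neg_app, e]
    simp)
  refine ⟨y, ?_⟩
  have h := congrArg (F.map (biprod.snd : d.M ⊞ D ⟶ D)) hy
  rw [map_add, ← map_comp_app, ← map_comp_app, ← map_comp_app, biprod.lift_snd, biprod.inl_snd,
    biprod.inr_snd, map_zero_app] at h
  simpa using h

/-- Exactness of `F D ⟶ sat F A ⟶ sat F B` at `sat F A`. -/
lemma HalfExact.exists_satMk_eq (hF : HalfExact S F) {A D : C} (c : Conflation S D A)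
    (y : (sat F hS).obj A) (hy : (sat F hS).map c.i y = 0) : ∃ x, satMk F c x = y := by
  obtain ⟨K, a, x, rfl⟩ := satMk_surjective F hS y
  obtain ⟨a', h', -⟩ := a.exists_pushout hS c.i
  rw [sat_map_mk F hS h'] at hy
  obtain ⟨L, d, k, z, hk, e⟩ := (satMk_eq_zero_iff F hS _ _).1 hy
  obtain ⟨Q, r, l, s, hr, hl, h₁, h₂⟩ := c.isConf.comp_inflation hS d.isConf
  have ht := h'.trans hk
  simp only [Category.id_comp, Category.comp_id] at ht
  obtain ⟨m, hm, hm'⟩ := ht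
  -- `a` maps to the conflation `A ⟶ d.M ⟶ Q`, and `Q` is an extension of `L` by `D`
  obtain ⟨q, hq⟩ := a.isConf.desc hS (m ≫ r) (by
    rw [← Category.assoc, hm, hr.w])
  have haq : a.HasMor hr.conf q (𝟙 A) := ⟨m, by simpa [IsConf.conf] using hm, hq⟩
  have hqs : q ≫ s = k := by
    have := a.isConf.epi hS
    rw [← cancel_epi a.p, ← Category.assoc, hq, Category.assoc, h₂, hm']
  obtain ⟨x₁, hx₁⟩ := hF _ _ hl (F.map q x - F.map r z) (by
    rw [map_sub, ← map_comp_app, ← map_comp_app, hqs, h₂, sub_eq_zero]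
    simpa using e)
  refine ⟨x₁, ?_⟩
  have hcr : c.HasMor hr.conf l (𝟙 A) := ⟨d.i, by simp [IsConf.conf], h₁⟩
  rw [← satMk_eq_of_hasMor F hS haq, ← satMk_eq_of_hasMor F hS hcr, hx₁, map_sub]
  rw [satMk_conf_p, sub_zero]

lemma HalfExact.sat [HasZeroObject C] [HasBinaryBiproducts C] (hF : HalfExact S F) :
    HalfExact S (sat F hS) := by
  intro A B D i p h y hy
  obtain ⟨K, c, x, rfl⟩ := satMk_surjective F hS y
  -- the pushout of `c` along `p` is `D ⟶ P ⟶ K` with `A ⟶ c.M ⟶ P` a conflation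
  obtain ⟨P, r, k, s, hr, hk, h₁, h₂⟩ := h.comp_inflation hS c.isConf
  have hm : c.HasMor hk.conf (𝟙 K) p := ⟨r, h₁.symm, by simpa [IsConf.conf] using h₂.symm⟩
  rw [sat_map_mk F hS hm] at hy
  obtain ⟨w, hw⟩ : ∃ w : F.obj P, F.map s w = F.map (𝟙 K) x :=
    hF.exists_of_satMk_eq_zero F hS _ _ hy
  have hi : hr.conf.HasMor c s i := ⟨𝟙 _, by simp [IsConf.conf], by simpa [IsConf.conf] using h₂⟩
  refine ⟨satMk F hr.conf w, (sat_map_mk F hS hi w).trans ?_⟩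
  rw [hw, F.map_id]
  rfl

variable {F}

/-- The transformation of satellites induced by a natural transformation. -/
noncomputable def satNat {G : C ⥤ AddCommGrpCat.{max u v}} [G.Additive] (α : F ⟶ G) :
    sat F hS ⟶ sat G hS where
  app Y := AddCommGrpCat.ofHom (satNatApp hS α Y)
  naturality Y Y' b := by
    ext y
    obtain ⟨K, c, x, rfl⟩ := satMk_surjective F hS y
    obtain ⟨c', h', -⟩ := c.exists_pushout hS b
    change satNatApp hS α Y' ((sat F hS).map b (satMk F c x)) =
      (sat G hS).map b (satNatApp hS α Y (satMk F c x))
    rw [sat_map_mk F hS h', satNatApp_mk, satNatApp_mk, sat_map_mk G hS h', naturality_app]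

lemma satNat_mk {G : C ⥤ AddCommGrpCat.{max u v}} [G.Additive] (α : F ⟶ G) {K Y : C}
    (c : Conflation S K Y) (x : F.obj K) :
    (satNat hS α).app Y (satMk F c x) = satMk G c (α.app K x) :=
  satNatApp_mk hS α c x

lemma StablyExact.sat {G H : C ⥤ AddCommGrpCat.{max u v}} [G.Additive] [H.Additive]
    {α : F ⟶ G} {β : G ⟶ H} (h : StablyExact S α β) :
    StablyExact S (satNat hS α) (satNat hS β) where
  exact Y y hy := by
    obtain ⟨K, c, g, rfl⟩ := satMk_surjective G hS y
    rw [satNat_mk] at hy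
    obtain ⟨L, d, k, z, hk, e⟩ := (satMk_eq_zero_iff H hS _ _).1 hy
    -- after enlarging `d`, the element `z` comes from `G`
    obtain ⟨M, Q, i, p, hi, g₁, hg₁⟩ := h.effaceable _ z
    obtain ⟨P, r, l, s, hr, -, h₁, -⟩ := d.isConf.comp_inflation hS hi
    have hl : d.HasMor hr.conf l (𝟙 Y) := ⟨i, by simp [IsConf.conf], h₁⟩
    have hkl : c.HasMor hr.conf (k ≫ l) (𝟙 Y) := by simpa using hk.trans hl
    obtain ⟨f, hf⟩ := h.exact _ (G.map (k ≫ l) g - G.map r g₁) (by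
      rw [map_sub, naturality_app, naturality_app, ← hg₁, map_comp_app, e, ← map_comp_app, h₁,
        map_comp_app, sub_self])
    refine ⟨satMk F hr.conf f, ?_⟩
    rw [satNat_mk, hf, map_sub, satMk_eq_of_hasMor G hS hkl]
    rw [satMk_conf_p, sub_zero]
  effaceable Y y := by
    obtain ⟨M, K, i, p, h, e⟩ := sat_effaceable H hS y
    exact ⟨M, K, i, p, h, 0, by rw [e, map_zero]⟩

end Exactness

/-! ### Extension groups as iterated satellites of the Hom functor -/

section ExtFunctor

variable {C : Type u} [Category.{v} C] [Preadditive C] {S : ObjectProperty (ShortComplex C)}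

/-- The functor `Hom(X, -)`, with values in a universe that is large enough to take satellites. -/
def homFun (X : C) : C ⥤ AddCommGrpCat.{max u v} where
  obj Y := AddCommGrpCat.of (ULift.{u} (X ⟶ Y))
  map f := AddCommGrpCat.ofHom
    { toFun := fun t => ⟨t.down ≫ f⟩
      map_zero' := by ext; simp
      map_add' := fun a b => by ext; simp }
  map_id Y := AddCommGrpCat.ext fun t => ULift.ext _ _ (Category.comp_id t.down)
  map_comp f g := AddCommGrpCat.ext fun t => ULift.ext _ _ (Category.assoc t.down f g).symm

instance (X : C) : (homFun X).Additive where
  map_add {_ _ f g} := AddCommGrpCat.ext fun t =>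
    ULift.ext _ _ (Preadditive.comp_add _ _ _ (ULift.down t) f g)

/-- Elements of `homFun X` are morphisms from `X`. -/
def homEquiv {X Y : C} : (X ⟶ Y) ≃+ (homFun X).obj Y := AddEquiv.ulift.symm

lemma homFun_map {X Y Z : C} (t : X ⟶ Y) (f : Y ⟶ Z) :
    (homFun X).map f (homEquiv t) = homEquiv (t ≫ f) := rfl

/-- Precomposition as a transformation of Hom functors. -/
def homNat {X X' : C} (f : X ⟶ X') : homFun X' ⟶ homFun X where
  app Y := AddCommGrpCat.ofHom
    { toFun := fun t => ⟨f ≫ t.down⟩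
      map_zero' := by ext; simp
      map_add' := fun a b => by ext; simp }
  naturality Y Z g := AddCommGrpCat.ext fun t =>
    ULift.ext _ _ (Category.assoc f (ULift.down t) g).symm

lemma homNat_app {X X' Y : C} (f : X ⟶ X') (t : X' ⟶ Y) :
    (homNat f).app Y (homEquiv t) = homEquiv (f ≫ t) := rfl

variable (hS : IsExactStructure S)

include hS

/-- The iterated satellites of `Hom(X, -)`, bundled with their additivity. -/
noncomputable def extAux (X : C) : ℕ → {F : C ⥤ AddCommGrpCat.{max u v} // F.Additive}
  | 0 => ⟨homFun X, inferInstance⟩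
  | n + 1 => ⟨@sat _ _ _ _ (extAux X n).1 hS (extAux X n).2,
      @sat_additive _ _ _ _ (extAux X n).1 hS (extAux X n).2⟩

/-- The functor `Ext^n(X, -)`, as the `n`-th satellite of `Hom(X, -)`. -/
noncomputable def extFun (X : C) (n : ℕ) : C ⥤ AddCommGrpCat.{max u v} := (extAux hS X n).1

instance (X : C) (n : ℕ) : (extFun hS X n).Additive := (extAux hS X n).2

lemma halfExact_homFun (X : C) : HalfExact S (homFun X) := by
  intro A B D i p h x hx
  obtain ⟨t, rfl⟩ := homEquiv.surjective x
  rw [homFun_map, EmbeddingLike.map_eq_zero_iff] at hx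
  obtain ⟨y, rfl⟩ := h.lift hS t hx
  exact ⟨homEquiv y, rfl⟩

lemma halfExact_extFun [HasZeroObject C] [HasBinaryBiproducts C] (X : C) (n : ℕ) :
    HalfExact S (extFun hS X n) := by
  induction n with
  | zero => exact halfExact_homFun hS X
  | succ n ih => exact HalfExact.sat (extFun hS X n) hS ih

/-- The connecting transformation `Hom(A, -) ⟶ Ext^1(D, -)` of a conflation `A ⟶ B ⟶ D`. -/
noncomputable def homConn {A D : C} (c : Conflation S D A) : homFun A ⟶ sat (homFun D) hS where
  app Y := AddCommGrpCat.ofHom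
    ((AddMonoidHom.mk' (fun t : A ⟶ Y =>
      (sat (homFun D) hS).map t (satMk (homFun D) c (homEquiv (𝟙 D))))
      fun _ _ => map_add_app _ _ _ _).comp (homEquiv (X := A) (Y := Y)).symm.toAddMonoidHom)
  naturality _ _ g := AddCommGrpCat.ext fun t =>
    map_comp_app (sat (homFun D) hS) (homEquiv.symm t) g
    (satMk (homFun D) c (homEquiv (𝟙 D)))

lemma homConn_app {A D Y K : C} (c : Conflation S D A) (t : A ⟶ Y)
    (d : Conflation S K Y) (k : D ⟶ K) (h : c.HasMor d k t) :
    (homConn hS c).app Y (homEquiv t) = satMk (homFun D) d (homEquiv k) := by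
  have := sat_map_mk (homFun D) hS h (homEquiv (𝟙 D))
  rw [homFun_map, Category.id_comp] at this
  change (sat (homFun D) hS).map (homEquiv.symm (homEquiv t)) _ = _
  rw [AddEquiv.symm_apply_apply]
  exact this

/-- `Hom(D, -) ⟶ Hom(B, -) ⟶ Hom(A, -)` for a conflation `A ⟶ B ⟶ D`. -/
lemma stablyExact_hom {A D : C} (c : Conflation S D A) :
    StablyExact S (homNat c.p) (homNat c.i) where
  exact Y g hg := by
    obtain ⟨t, rfl⟩ := homEquiv.surjective g
    rw [homNat_app, EmbeddingLike.map_eq_zero_iff] at hg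
    obtain ⟨f, rfl⟩ := c.isConf.desc hS t hg
    exact ⟨homEquiv f, rfl⟩
  effaceable Y h := by
    obtain ⟨t, rfl⟩ := homEquiv.surjective h
    obtain ⟨M, g, i, p, sq, hi, -⟩ := c.isConf.pushout hS t
    refine ⟨M, D, i, p, hi, homEquiv g, ?_⟩
    rw [homFun_map, homNat_app, sq.w]

/-- `Hom(B, -) ⟶ Hom(A, -) ⟶ Ext^1(D, -)` for a conflation `A ⟶ B ⟶ D`. -/
lemma stablyExact_homConn {A D : C} (c : Conflation S D A) :
    StablyExact S (homNat c.i) (homConn hS c) where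
  exact Y t ht := by
    obtain ⟨t, rfl⟩ := homEquiv.surjective t
    obtain ⟨c', h', -⟩ := c.exists_pushout hS t
    rw [homConn_app hS c t c' _ h'] at ht
    obtain ⟨L, d, k, z, h, e⟩ := (satMk_eq_zero_iff _ hS _ _).1 ht
    obtain ⟨z, rfl⟩ := homEquiv.surjective z
    rw [homFun_map, homFun_map, EmbeddingLike.apply_eq_iff_eq] at e
    obtain ⟨m, h₁, h₂⟩ := h'.trans h
    -- `m` and the lift of `k` differ by a map `c.M ⟶ Y` that extends `t`
    obtain ⟨f, hf⟩ := d.isConf.lift hS (m - c.p ≫ z) (by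
      rw [Preadditive.sub_comp, ← h₂, Category.assoc, ← e, sub_self])
    have := d.isConf.mono hS
    refine ⟨homEquiv f, ?_⟩
    rw [homNat_app]
    congr 1
    rw [← cancel_mono d.i, Category.assoc, hf, Preadditive.comp_sub, h₁, ← Category.assoc c.i,
      c.zero]
    simp
  effaceable Y y := by
    obtain ⟨M, K, i, p, h, e⟩ := sat_effaceable _ hS y
    exact ⟨M, K, i, p, h, 0, by rw [e, map_zero]⟩

/-- `Hom(A, -) ⟶ Ext^1(D, -) ⟶ Ext^1(B, -)` for a conflation `A ⟶ B ⟶ D`. -/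
lemma stablyExact_homConn_sat {A D : C} (c : Conflation S D A) :
    StablyExact S (homConn hS c) (satNat hS (homNat c.p)) where
  exact Y y hy := by
    obtain ⟨K, d, t, rfl⟩ := satMk_surjective _ hS y
    obtain ⟨t, rfl⟩ := homEquiv.surjective t
    rw [satNat_mk, homNat_app] at hy
    obtain ⟨L, e, k, z, h, he⟩ := (satMk_eq_zero_iff _ hS _ _).1 hy
    obtain ⟨z, rfl⟩ := homEquiv.surjective z
    rw [homFun_map, homFun_map, EmbeddingLike.apply_eq_iff_eq] at he
    obtain ⟨s, hs⟩ := e.isConf.lift hS (c.i ≫ z) (by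
      rw [Category.assoc, ← he, ← Category.assoc, ← Category.assoc, c.zero]
      simp)
    refine ⟨homEquiv s, ?_⟩
    rw [homConn_app hS c _ e (t ≫ k) ⟨z, hs.symm, by simpa using he⟩,
      ← satMk_eq_of_hasMor _ hS h, homFun_map]
  effaceable Y y := by
    obtain ⟨M, K, i, p, h, e⟩ := sat_effaceable _ hS y
    exact ⟨M, K, i, p, h, 0, by rw [e, map_zero]⟩

lemma exists_stablyExact₁ {A D : C} (c : Conflation S D A) (n : ℕ) :
    ∃ (α : extFun hS D n ⟶ extFun hS c.M n) (β : extFun hS c.M n ⟶ extFun hS A n),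
      StablyExact S α β := by
  induction n with
  | zero => exact ⟨_, _, stablyExact_hom hS c⟩
  | succ n ih =>
    obtain ⟨α, β, h⟩ := ih
    exact ⟨_, _, h.sat hS⟩

lemma exists_stablyExact₂ {A D : C} (c : Conflation S D A) (n : ℕ) :
    ∃ (α : extFun hS c.M n ⟶ extFun hS A n) (β : extFun hS A n ⟶ extFun hS D (n + 1)),
      StablyExact S α β := by
  induction n with
  | zero => exact ⟨_, _, stablyExact_homConn hS c⟩
  | succ n ih =>
    obtain ⟨α, β, h⟩ := ih
    exact ⟨_, _, h.sat hS⟩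

lemma exists_stablyExact₃ {A D : C} (c : Conflation S D A) (n : ℕ) :
    ∃ (α : extFun hS A n ⟶ extFun hS D (n + 1))
      (β : extFun hS D (n + 1) ⟶ extFun hS c.M (n + 1)), StablyExact S α β := by
  induction n with
  | zero => exact ⟨_, _, stablyExact_homConn_sat hS c⟩
  | succ n ih =>
    obtain ⟨α, β, h⟩ := ih
    exact ⟨_, _, h.sat hS⟩

end ExtFunctor

/-! ### Vanishing of Yoneda extension groups -/

section Vanishing

variable {C : Type u} [Category.{v} C] [Preadditive C] {S : ObjectProperty (ShortComplex C)}

/-- The vanishing of `Ext^{n+1}(X, Y)`. -/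
abbrev ExtVanish (S : ObjectProperty (ShortComplex C)) (n : ℕ) (X Y : C) : Prop :=
  Subsingleton (ExtSucc S n X Y)

lemma Extension.HasMor.refl (n : ℕ) {X Y : C} (e : Extension S n X Y) :
    Extension.HasMor S n e e (𝟙 X) (𝟙 Y) := by
  induction n generalizing Y with
  | zero => exact Conflation.HasMor.refl _
  | succ n ih => exact ⟨𝟙 _, .refl _, ih _⟩

variable (hS : IsExactStructure S)

/-- The class of an exact sequence in the iterated satellite of the Hom functor. -/
noncomputable def extClass : (n : ℕ) → {X Y : C} → Extension S n X Y → (extFun hS X (n + 1)).obj Y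
  | 0, X, _, c => satMk (homFun X) c (homEquiv (𝟙 X))
  | n + 1, X, _, e => satMk (extFun hS X (n + 1)) e.2.1 (extClass n e.2.2)

lemma extClass_hasMor (n : ℕ) {X Y Y' : C} {e : Extension S n X Y} {f : Extension S n X Y'}
    {b : Y ⟶ Y'} (h : Extension.HasMor S n e f (𝟙 X) b) :
    (extFun hS X (n + 1)).map b (extClass hS n e) = extClass hS n f := by
  induction n generalizing Y Y' with
  | zero =>
    have := sat_map_mk (homFun X) hS (c := e) (d := f) h (homEquiv (𝟙 X))
    rwa [homFun_map, Category.comp_id] at this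
  | succ n ih =>
    obtain ⟨k, h₁, h₂⟩ := h
    exact (sat_map_mk (extFun hS X (n + 1)) hS h₁ _).trans (congrArg _ (ih h₂))

lemma extClass_surjective (n : ℕ) {X Y : C} (y : (extFun hS X (n + 1)).obj Y) :
    ∃ e : Extension S n X Y, extClass hS n e = y := by
  induction n generalizing Y with
  | zero =>
    obtain ⟨K, c, t, rfl⟩ := satMk_surjective (homFun X) hS y
    obtain ⟨t, rfl⟩ := homEquiv.surjective t
    obtain ⟨B, g, i, p, sq, h, hg⟩ := c.isConf.pullback hS t
    have hm : h.conf.HasMor c t (𝟙 Y) := ⟨g, by simpa [IsConf.conf] using hg, sq.w.symm⟩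
    refine ⟨h.conf, ?_⟩
    have := satMk_eq_of_hasMor (homFun X) hS hm (homEquiv (𝟙 X))
    rw [homFun_map, Category.id_comp] at this
    exact this.symm
  | succ n ih =>
    obtain ⟨K, c, x, rfl⟩ := satMk_surjective (extFun hS X (n + 1)) hS y
    obtain ⟨e, rfl⟩ := ih x
    exact ⟨⟨K, c, e⟩, rfl⟩

include hS

lemma Extension.exists_pushout (n : ℕ) {X Y Y' : C} (e : Extension S n X Y) (b : Y ⟶ Y') :
    ∃ f : Extension S n X Y', Extension.HasMor S n e f (𝟙 X) b := by
  cases n with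
  | zero =>
    obtain ⟨c', h, -⟩ := Conflation.exists_pushout hS e b
    exact ⟨c', h⟩
  | succ n =>
    obtain ⟨c', h, -⟩ := e.2.1.exists_pushout hS b
    exact ⟨⟨e.1, c', e.2.2⟩, 𝟙 _, h, .refl n e.2.2⟩

section

variable [HasZeroObject C] [HasBinaryBiproducts C]

open ZeroObject

/-- The trivial exact sequences: the split sequence `Y ⟶ Y ⊞ X ⟶ X` and the sequences
`Y = Y ⟶ 0 ⟶ ⋯ ⟶ 0 ⟶ X = X`. -/
noncomputable def zeroExtension : (n : ℕ) → (X Y : C) → Extension S n X Y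
  | 0, X, Y => (isConf_inl_snd hS Y X).conf
  | n + 1, X, Y => ⟨0, (isConf_of_isIso_of_isZero hS (𝟙 Y) (isZero_zero C) 0).conf,
      zeroExtension n X 0⟩

lemma zeroExtension_hasMor (n : ℕ) (X : C) {Y Y' : C} (b : Y ⟶ Y') :
    Extension.HasMor S n (zeroExtension hS n X Y) (zeroExtension hS n X Y') (𝟙 X) b := by
  induction n generalizing Y Y' with
  | zero => exact ⟨biprod.map b (𝟙 X), biprod.inl_map _ _, (biprod.map_snd _ _).symm⟩
  | succ n ih => exact ⟨0, ⟨b, by simp [zeroExtension, IsConf.conf],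
      (isZero_zero C).eq_of_tgt _ _⟩, ih 0⟩

lemma quot_eq_zeroExtension (n : ℕ) {X Y : C} (e : Extension S n X Y)
    (he : extClass hS n e = 0) :
    (Quot.mk _ e : ExtSucc S n X Y) = Quot.mk _ (zeroExtension hS n X Y) := by
  induction n generalizing Y with
  | zero =>
    revert e
    intro (e : Conflation S X Y) he
    obtain ⟨L, d, k, z, ⟨m, h₁, h₂⟩, h⟩ := (satMk_eq_zero_iff _ hS _ _).1 he
    obtain ⟨z, rfl⟩ := homEquiv.surjective z
    rw [homFun_map, homFun_map, EmbeddingLike.apply_eq_iff_eq, Category.id_comp] at h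
    obtain ⟨r, hr⟩ := d.isConf.lift hS (m - e.p ≫ z) (by
      rw [Preadditive.sub_comp, ← h₂, Category.assoc, ← h, sub_self])
    have := d.isConf.mono hS
    refine Quot.sound ⟨biprod.lift r (e.p), ?_, by simp [zeroExtension, IsConf.conf]⟩
    have hir : e.i ≫ r = 𝟙 Y := by
      rw [← cancel_mono d.i, Category.assoc, hr, Preadditive.comp_sub, h₁, ← Category.assoc,
        e.zero]
      simp
    have := e.zero
    apply biprod.hom_ext <;> simp [zeroExtension, IsConf.conf, hir, this]
  | succ n ih =>
    obtain ⟨K, c, e⟩ := e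
    obtain ⟨L, d, k, z, h, hk⟩ := (satMk_eq_zero_iff (extFun hS X (n + 1)) hS _ _).1 he
    -- enlarge `d` so that `z`, hence also the image of the class of `e`, vanishes
    obtain ⟨M, Q, i, p, hi, hz⟩ := sat_effaceable (extFun hS X n) hS z
    obtain ⟨P, r, l, s, hr, -, h₁, -⟩ := d.isConf.comp_inflation hS hi
    have hl : d.HasMor hr.conf l (𝟙 Y) := ⟨i, by simp [IsConf.conf], h₁⟩
    have hkl : c.HasMor hr.conf (k ≫ l) (𝟙 Y) := by simpa using h.trans hl
    obtain ⟨f, hf⟩ := Extension.exists_pushout hS n e (k ≫ l)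
    have hf0 : extClass hS n f = 0 := by
      have hz : (extFun hS X (n + 1)).map i z = 0 := hz
      rw [← extClass_hasMor hS n hf, map_comp_app, hk, ← map_comp_app, h₁, map_comp_app, hz,
        map_zero]
    let g : ExtSucc S n X P → ExtSucc S (n + 1) X Y :=
      Quot.map (fun f => ⟨P, hr.conf, f⟩) fun f f' h => ⟨𝟙 _, .refl _, h⟩
    calc (Quot.mk _ ⟨K, c, e⟩ : ExtSucc S (n + 1) X Y)
        = Quot.mk _ ⟨P, hr.conf, f⟩ := Quot.sound ⟨_, hkl, hf⟩
      _ = Quot.mk _ ⟨P, hr.conf, zeroExtension hS n X P⟩ := congrArg g (ih f hf0)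
      _ = _ := (Quot.sound ⟨0, ⟨d.i ≫ i, by simp [zeroExtension, IsConf.conf],
          zero_comp.trans hr.w.symm⟩, zeroExtension_hasMor hS n X 0⟩).symm

/-- Yoneda's `Ext^{n+1}(X, Y)` vanishes if and only if the corresponding satellite does. -/
lemma extVanish_iff (n : ℕ) (X Y : C) :
    ExtVanish S n X Y ↔ ∀ y : (extFun hS X (n + 1)).obj Y, y = 0 := by
  constructor
  · intro h y
    obtain ⟨e, rfl⟩ := extClass_surjective hS n y
    obtain ⟨f, hf⟩ := extClass_surjective hS n (0 : (extFun hS X (n + 1)).obj Y)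
    let g : ExtSucc S n X Y → (extFun hS X (n + 1)).obj Y :=
      Quot.lift (extClass hS n) fun e f h => by simpa using extClass_hasMor hS n h
    rw [← hf]
    exact congrArg g (h.elim (Quot.mk _ e) (Quot.mk _ f))
  · intro h
    refine ⟨fun a b => ?_⟩
    obtain ⟨e, rfl⟩ := Quot.exists_rep a
    obtain ⟨f, rfl⟩ := Quot.exists_rep b
    rw [quot_eq_zeroExtension hS n e (h _), quot_eq_zeroExtension hS n f (h _)]

/-! In the next lemmas `A ⟶ B ⟶ D` is a conflation. -/

variable {A B D : C} {i : A ⟶ B} {p : B ⟶ D} (h : IsConf S i p)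

include h

lemma ExtVanish.right_middle {n : ℕ} {X : C} (hA : ExtVanish S n X A) (hD : ExtVanish S n X D) :
    ExtVanish S n X B := by
  rw [extVanish_iff hS] at *
  intro y
  obtain ⟨x, rfl⟩ := halfExact_extFun hS X (n + 1) i p h y (hD _)
  rw [hA x, map_zero]

lemma ExtVanish.right_third {n : ℕ} {X : C} (hB : ExtVanish S n X B)
    (hA : ExtVanish S (n + 1) X A) : ExtVanish S n X D := by
  rw [extVanish_iff hS] at *
  intro y
  obtain ⟨x, rfl⟩ : ∃ x : (extFun hS X (n + 1)).obj B, (extFun hS X (n + 1)).map p x = y :=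
    (halfExact_extFun hS X (n + 1)).exists_of_satMk_eq_zero _ hS h.conf y (hA _)
  rw [hB x, map_zero]

lemma ExtVanish.right_first {n : ℕ} {X : C} (hD : ExtVanish S n X D)
    (hB : ExtVanish S (n + 1) X B) : ExtVanish S (n + 1) X A := by
  rw [extVanish_iff hS] at *
  intro y
  obtain ⟨x, rfl⟩ := (halfExact_extFun hS X (n + 1)).exists_satMk_eq _ hS h.conf y (hB _)
  have : x = 0 := hD x
  rw [this, map_zero]
  rfl

lemma ExtVanish.left_middle {n : ℕ} {Y : C} (hA : ExtVanish S n A Y) (hD : ExtVanish S n D Y) :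
    ExtVanish S n B Y := by
  rw [extVanish_iff hS] at *
  intro y
  obtain ⟨α, β, hαβ⟩ := exists_stablyExact₁ hS h.conf (n + 1)
  obtain ⟨x, rfl⟩ := hαβ.exact Y y (hA _)
  rw [hD x, map_zero]
  rfl

lemma ExtVanish.left_first {n : ℕ} {Y : C} (hB : ExtVanish S n B Y)
    (hD : ExtVanish S (n + 1) D Y) : ExtVanish S n A Y := by
  rw [extVanish_iff hS] at *
  intro y
  obtain ⟨α, β, hαβ⟩ := exists_stablyExact₂ hS h.conf (n + 1)
  obtain ⟨x, rfl⟩ := hαβ.exact Y y (hD _)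
  have : x = 0 := hB x
  rw [this, map_zero]

lemma ExtVanish.left_third {n : ℕ} {Y : C} (hA : ExtVanish S n A Y)
    (hB : ExtVanish S (n + 1) B Y) : ExtVanish S (n + 1) D Y := by
  rw [extVanish_iff hS] at *
  intro y
  obtain ⟨α, β, hαβ⟩ := exists_stablyExact₃ hS h.conf (n + 1)
  obtain ⟨x, rfl⟩ := hαβ.exact Y y (hB _)
  rw [hA x, map_zero]

end

section

variable [HasZeroObject C] [HasBinaryBiproducts C]

open ZeroObject

lemma extVanish_of_isProj {P : C} (hP : IsProj S P) (n : ℕ) (Y : C) : ExtVanish S n P Y := by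
  rw [extVanish_iff hS]
  induction n generalizing Y with
  | zero =>
    intro y
    obtain ⟨K, c, t, rfl⟩ := satMk_surjective (homFun P) hS y
    obtain ⟨t, rfl⟩ := homEquiv.surjective t
    obtain ⟨g, rfl⟩ := hP c.p ⟨_, c.i, c.zero, c.mem⟩ t
    exact satMk_p (homFun P) c (homEquiv g)
  | succ n ih => exact sat_eq_zero (extFun hS P (n + 1)) hS ih Y

lemma extVanish_of_isZero_left {Z : C} (hZ : IsZero Z) (n : ℕ) (Y : C) : ExtVanish S n Z Y :=
  extVanish_of_isProj hS (fun _ _ _ => ⟨0, hZ.eq_of_src _ _⟩) n Y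

lemma extVanish_of_isZero_right {Z : C} (hZ : IsZero Z) (n : ℕ) (X : C) : ExtVanish S n X Z := by
  rw [extVanish_iff hS]
  intro y
  have := map_zero_app (extFun hS X (n + 1)) (X := Z) (Y := Z) y
  rw [← hZ.eq_of_src (𝟙 Z) 0] at this
  simpa using this

lemma ExtVanish.of_iso_right {n : ℕ} {X Y Y' : C} (h : ExtVanish S n X Y) (e : Y ≅ Y') :
    ExtVanish S n X Y' := by
  have hc := isConf_of_isZero_of_isIso hS (0 : 0 ⟶ Y) (isZero_zero C) e.hom
  exact h.right_third hS hc (extVanish_of_isZero_right hS (isZero_zero C) _ _)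

lemma ExtVanish.of_iso_left {n : ℕ} {X X' Y : C} (h : ExtVanish S n X Y) (e : X' ≅ X) :
    ExtVanish S n X' Y := by
  have hc := isConf_of_isIso_of_isZero hS e.hom (isZero_zero C) 0
  exact h.left_first hS hc (extVanish_of_isZero_left hS (isZero_zero C) _ _)

/-- `Ext^1(X, Y)` vanishes if and only if every conflation `Y ⟶ M ⟶ X` splits. -/
lemma extVanish_zero_iff {X Y : C} : ExtVanish S 0 X Y ↔
    ∀ ⦃M : C⦄ (i : Y ⟶ M) (p : M ⟶ X), IsConf S i p → ∃ s, s ≫ p = 𝟙 X := by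
  rw [extVanish_iff hS]
  constructor
  · intro h M i p hip
    obtain ⟨w, hw⟩ := (halfExact_homFun hS X).exists_of_satMk_eq_zero _ hS hip.conf
      (homEquiv (𝟙 X)) (h _)
    obtain ⟨s, rfl⟩ := homEquiv.surjective w
    exact ⟨s, homEquiv.injective hw⟩
  · intro h y
    obtain ⟨c, rfl⟩ := extClass_surjective hS 0 y
    obtain ⟨s, hs⟩ := h _ _ (Conflation.isConf c)
    have := satMk_p (homFun X) c (homEquiv s)
    rw [homFun_map, hs] at this
    exact this

/-- If `Ext^1(X, A) = 0` then morphisms from `X` lift along deflations with kernel `A`. -/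
lemma ExtVanish.exists_lift {X A B D : C} (h : ExtVanish S 0 X A) {i : A ⟶ B} {p : B ⟶ D}
    (hip : IsConf S i p) (f : X ⟶ D) : ∃ g, g ≫ p = f := by
  obtain ⟨Q, g, j, q, sq, hj, -⟩ := hip.pullback hS f
  obtain ⟨s, hs⟩ := (extVanish_zero_iff hS).1 h j q hj
  exact ⟨s ≫ g, by rw [Category.assoc, sq.w, ← Category.assoc, hs, Category.id_comp]⟩

end

end Vanishing

/-! ### Fully exact subcategories -/

section Restrict

variable {C : Type u} [Category.{v} C] [Preadditive C] {S : ObjectProperty (ShortComplex C)}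

/-- `𝒳` is closed under extensions. -/
def ExtClosed (S : ObjectProperty (ShortComplex C)) (𝒳 : ObjectProperty C) : Prop :=
  ∀ ⦃A B D : C⦄ (i : A ⟶ B) (p : B ⟶ D), IsConf S i p → 𝒳 A → 𝒳 D → 𝒳 B

/-- `𝒳` is closed under cokernels of inflations. -/
def CokerClosed (S : ObjectProperty (ShortComplex C)) (𝒳 : ObjectProperty C) : Prop :=
  ∀ ⦃A B D : C⦄ (i : A ⟶ B) (p : B ⟶ D), IsConf S i p → 𝒳 A → 𝒳 B → 𝒳 D

variable {𝒳 : ObjectProperty C}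

lemma isConf_restrict_iff {A B D : 𝒳.FullSubcategory} (i : A ⟶ B) (p : B ⟶ D) :
    IsConf (restrict S 𝒳) i p ↔ IsConf S i.hom p.hom :=
  ⟨fun h => ⟨congrArg (·.hom) h.1, h.2⟩, fun h => ⟨ObjectProperty.hom_ext _ h.1, h.2⟩⟩

lemma hasBinaryBiproducts_fullSubcategory [HasBinaryBiproducts C]
    (hX : ∀ A B, 𝒳 A → 𝒳 B → 𝒳 (A ⊞ B)) : HasBinaryBiproducts 𝒳.FullSubcategory where
  has_binary_biproduct A B := hasBinaryBiproduct_of_total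
    { pt := ⟨A.obj ⊞ B.obj, hX _ _ A.2 B.2⟩
      fst := ObjectProperty.homMk biprod.fst
      snd := ObjectProperty.homMk biprod.snd
      inl := ObjectProperty.homMk biprod.inl
      inr := ObjectProperty.homMk biprod.inr
      inl_fst := ObjectProperty.hom_ext _ biprod.inl_fst
      inl_snd := ObjectProperty.hom_ext _ biprod.inl_snd
      inr_fst := ObjectProperty.hom_ext _ biprod.inr_fst
      inr_snd := ObjectProperty.hom_ext _ biprod.inr_snd }
    (ObjectProperty.hom_ext _ biprod.total)

variable (hS : IsExactStructure S)

include hS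

/-- An extension-closed subcategory that contains the zero objects is exact. -/
lemma isExactStructure_restrict (hE : ExtClosed S 𝒳) (hZ : ∀ Z, IsZero Z → 𝒳 Z) :
    IsExactStructure (restrict S 𝒳) where
  of_iso := fun ⟨e⟩ h => hS.of_iso ⟨𝒳.ι.mapShortComplex.mapIso e⟩ h
  isKernel E hE := by
    have h : IsConf S E.f.hom E.g.hom := ⟨congrArg (·.hom) E.zero, hE⟩
    have : Mono E.f := 𝒳.ι.mono_of_mono_map (h.mono hS)
    refine ⟨KernelFork.IsLimit.ofι' _ _ fun {A} k hk => ?_⟩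
    have hl := h.lift hS k.hom (congrArg (·.hom) hk)
    exact ⟨ObjectProperty.homMk hl.choose, ObjectProperty.hom_ext _ hl.choose_spec⟩
  isCokernel E hE := by
    have h : IsConf S E.f.hom E.g.hom := ⟨congrArg (·.hom) E.zero, hE⟩
    have : Epi E.g := 𝒳.ι.epi_of_epi_map (h.epi hS)
    refine ⟨CokernelCofork.IsColimit.ofπ' _ _ fun {A} k hk => ?_⟩
    have hl := h.desc hS k.hom (congrArg (·.hom) hk)
    exact ⟨ObjectProperty.homMk hl.choose, ObjectProperty.hom_ext _ hl.choose_spec⟩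
  inflation_id A := by
    obtain ⟨Z, q, hq⟩ := hS.inflation_id A.obj
    have hq : IsConf S (𝟙 A.obj) q := hq
    have hz : IsZero Z := by
      have := hq.epi hS
      rw [IsZero.iff_id_eq_zero, ← cancel_epi q, ← Category.id_comp q, hq.w]
      simp
    exact ⟨⟨Z, hZ Z hz⟩, ObjectProperty.homMk q, (isConf_restrict_iff _ _).2 hq⟩
  deflation_id A := by
    obtain ⟨Z, q, hq⟩ := hS.deflation_id A.obj
    have hq : IsConf S q (𝟙 A.obj) := hq
    have hz : IsZero Z := by
      have := hq.mono hS
      rw [IsZero.iff_id_eq_zero, ← cancel_mono q, ← Category.comp_id q, hq.w]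
      simp
    exact ⟨⟨Z, hZ Z hz⟩, ObjectProperty.homMk q, (isConf_restrict_iff _ _).2 hq⟩
  inflation_comp i j := by
    rintro ⟨D, p, h⟩ ⟨F, q, h'⟩
    have h := (isConf_restrict_iff _ _).1 (show IsConf (restrict S 𝒳) i p from h)
    have h' := (isConf_restrict_iff _ _).1 (show IsConf (restrict S 𝒳) j q from h')
    obtain ⟨P, r, k, s, hr, hk, -⟩ := h.comp_inflation hS h'
    exact ⟨⟨P, hE k s hk D.2 F.2⟩, ObjectProperty.homMk r, (isConf_restrict_iff _ _).2 hr⟩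
  deflation_comp p q := by
    rintro ⟨A, i, h⟩ ⟨E, j, h'⟩
    have h := (isConf_restrict_iff _ _).1 (show IsConf (restrict S 𝒳) i p from h)
    have h' := (isConf_restrict_iff _ _).1 (show IsConf (restrict S 𝒳) j q from h')
    obtain ⟨P, r, k, s, hr, hk, -⟩ := h.comp_deflation hS h'
    exact ⟨⟨P, hE k s hk A.2 E.2⟩, ObjectProperty.homMk r, (isConf_restrict_iff _ _).2 hr⟩
  pushout {A B A₁} i f := by
    rintro ⟨D, p, h⟩
    have h := (isConf_restrict_iff _ _).1 (show IsConf (restrict S 𝒳) i p from h)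
    obtain ⟨B₁, g, i₁, p₁, sq, h₁, -⟩ := h.pushout hS f.hom
    refine ⟨⟨B₁, hE _ _ h₁ A₁.2 D.2⟩, ObjectProperty.homMk g, ObjectProperty.homMk i₁,
      IsPushout.of_map 𝒳.ι (ObjectProperty.hom_ext _ sq.w) sq, D, ObjectProperty.homMk p₁,
      (isConf_restrict_iff _ _).2 h₁⟩
  pullback {B D D₁} p f := by
    rintro ⟨A, i, h⟩
    have h := (isConf_restrict_iff _ _).1 (show IsConf (restrict S 𝒳) i p from h)
    obtain ⟨B₁, g, i₁, p₁, sq, h₁, -⟩ := h.pullback hS f.hom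
    refine ⟨⟨B₁, hE _ _ h₁ A.2 D₁.2⟩, ObjectProperty.homMk g, ObjectProperty.homMk p₁,
      IsPullback.of_map 𝒳.ι (ObjectProperty.hom_ext _ sq.w) sq, A, ObjectProperty.homMk i₁,
      (isConf_restrict_iff _ _).2 h₁⟩

lemma ExtClosed.of_iso [HasZeroObject C] (hE : ExtClosed S 𝒳) (hZ : ∀ Z, IsZero Z → 𝒳 Z)
    {A B : C} (e : A ≅ B) (hA : 𝒳 A) : 𝒳 B :=
  hE _ _ (isConf_of_isIso_of_isZero hS e.hom (isZero_zero C) 0) hA (hZ _ (isZero_zero C))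

variable [HasZeroObject C] [HasBinaryBiproducts C]

open ZeroObject

lemma ExtClosed.biprod (hE : ExtClosed S 𝒳) (A B : C) (hA : 𝒳 A) (hB : 𝒳 B) : 𝒳 (A ⊞ B) :=
  hE _ _ (isConf_inl_snd hS A B) hA hB

/-- If every object `X` of `𝒳` admits a conflation `X₁ ⟶ T ⟶ X` in `𝒳` with `T` in `𝒯`, and
objects of `𝒯` have no extensions with objects of `𝒳`, then the vanishing of extension
groups of objects of `𝒳` can be tested in `𝒳`. By dimension shift this reduces to `Ext^1`, where it
is clear because `𝒳` is closed under extensions. -/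
lemma extVanish_restrict_iff (hE : ExtClosed S 𝒳) (hZ : ∀ Z, IsZero Z → 𝒳 Z)
    {𝒯 : ObjectProperty C}
    (h𝒯 : ∀ X Y : 𝒳.FullSubcategory, 𝒯 X.obj → ∀ n,
      ExtVanish S n X.obj Y.obj ∧ ExtVanish (restrict S 𝒳) n X Y)
    (hres : ∀ X : 𝒳.FullSubcategory, ∃ (X₁ T : 𝒳.FullSubcategory) (i : X₁ ⟶ T) (p : T ⟶ X),
      𝒯 T.obj ∧ IsConf (restrict S 𝒳) i p) (n : ℕ) (X Y : 𝒳.FullSubcategory) :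
    ExtVanish S n X.obj Y.obj ↔ ExtVanish (restrict S 𝒳) n X Y := by
  have hSX := isExactStructure_restrict hS hE hZ
  have := hasBinaryBiproducts_fullSubcategory (hE.biprod hS)
  have : 𝒳.ContainsZero := ⟨0, isZero_zero C, hZ _ (isZero_zero C)⟩
  induction n generalizing X with
  | zero =>
    rw [extVanish_zero_iff hS, extVanish_zero_iff hSX]
    constructor
    · intro h M i p hip
      obtain ⟨s, hs⟩ := h _ _ ((isConf_restrict_iff i p).1 hip)
      exact ⟨ObjectProperty.homMk s, ObjectProperty.hom_ext _ hs⟩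
    · intro h M i p hip
      obtain ⟨s, hs⟩ := h (M := ⟨M, hE _ _ hip Y.2 X.2⟩) (ObjectProperty.homMk i)
        (ObjectProperty.homMk p) ((isConf_restrict_iff _ _).2 hip)
      exact ⟨s.hom, congrArg (·.hom) hs⟩
  | succ n ih =>
    obtain ⟨X₁, T, i, p, hT, hip⟩ := hres X
    have hip' := (isConf_restrict_iff i p).1 hip
    have hT₁ := fun n => (h𝒯 T Y hT n).1
    have hT₂ := fun n => (h𝒯 T Y hT n).2
    exact ⟨fun h => .left_third hSX hip ((ih X₁).1 (.left_first hS hip' (hT₁ n) h)) (hT₂ _),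
      fun h => .left_third hS hip' ((ih X₁).2 (.left_first hSX hip (hT₂ n) h)) (hT₁ _)⟩

end Restrict

/-! ### Perpendicular categories, resolutions and coresolutions -/

section Perp

variable {C : Type u} [Category.{v} C] [Preadditive C] {S : ObjectProperty (ShortComplex C)}
  {𝒯 𝒰 𝒳 : ObjectProperty C}

lemma cores_succ {n : ℕ} {M X Z : C} {i : M ⟶ X} {p : X ⟶ Z} (h : IsConf S i p) (hX : 𝒳 X)
    (hZ : Cores S 𝒳 n Z) : Cores S 𝒳 (n + 1) M :=
  ⟨X, Z, i, p, h.1, hX, h.2, hZ⟩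

lemma res_succ {n : ℕ} {M X Z : C} {i : Z ⟶ X} {p : X ⟶ M} (h : IsConf S i p) (hX : 𝒳 X)
    (hZ : Res S 𝒳 n Z) : Res S 𝒳 (n + 1) M :=
  ⟨Z, X, i, p, h.1, hX, h.2, hZ⟩

variable (hS : IsExactStructure S) [HasZeroObject C]

open ZeroObject

include hS

lemma cores_le_succ (h0 : ∀ Z, IsZero Z → 𝒳 Z) (m : ℕ) :
    Cores S 𝒳 m ≤ Cores S 𝒳 (m + 1) := by
  induction m with
  | zero =>
    rintro M ⟨X, hX, ⟨e⟩⟩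
    exact cores_succ (isConf_of_isIso_of_isZero hS e.hom (isZero_zero C) 0) hX
      ⟨0, h0 _ (isZero_zero C), ⟨Iso.refl _⟩⟩
  | succ m ih =>
    rintro M ⟨X, Z, i, p, w, hX, h, hZ⟩
    exact ⟨X, Z, i, p, w, hX, h, ih Z hZ⟩

lemma cores_mono (h0 : ∀ Z, IsZero Z → 𝒳 Z) : Monotone (Cores S 𝒳) :=
  monotone_nat_of_le_succ (cores_le_succ hS h0)

variable [HasBinaryBiproducts C]

lemma perp_extClosed : ExtClosed S (perp S 𝒯) := fun _ _ _ _ _ h hA hD X hX n =>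
  ExtVanish.right_middle hS h (hA X hX n) (hD X hX n)

lemma perp_cokerClosed : CokerClosed S (perp S 𝒯) := fun _ _ _ _ _ h hA hB X hX n =>
  ExtVanish.right_third hS h (hB X hX n) (hA X hX (n + 1))

lemma perp_of_isZero (Z : C) (hZ : IsZero Z) : perp S 𝒯 Z := fun X _ n =>
  extVanish_of_isZero_right hS hZ n X

/-- If `M` has a coresolution of length `k` by objects without extensions by `X`, then
`Ext^j(X, M) = 0` for `j > k`. -/
lemma extVanish_of_cores {X : C} (h : ∀ B, 𝒳 B → ∀ n, ExtVanish S n X B) {k : ℕ} {M : C}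
    (hM : Cores S 𝒳 k M) {j : ℕ} (hj : k ≤ j) : ExtVanish S j X M := by
  induction k generalizing M j with
  | zero =>
    obtain ⟨B, hB, ⟨e⟩⟩ := hM
    exact (h B hB j).of_iso_right hS e.symm
  | succ k ih =>
    obtain ⟨B, Z, i, p, w, hB, hip, hZ⟩ := hM
    obtain ⟨j, rfl⟩ : ∃ l, j = l + 1 := ⟨j - 1, by omega⟩
    exact .right_first hS ⟨w, hip⟩ (ih hZ (by omega)) (h B hB _)

/-- Objects with a finite coresolution by objects of `𝒳` have no extensions with `M` if the objects
of `𝒳` have none. -/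
lemma extVanish_left_of_cores {M : C} (h : ∀ B, 𝒳 B → ∀ n, ExtVanish S n B M) {k : ℕ} {Q : C}
    (hQ : Cores S 𝒳 k Q) (n : ℕ) : ExtVanish S n Q M := by
  induction k generalizing Q n with
  | zero =>
    obtain ⟨B, hB, ⟨e⟩⟩ := hQ
    exact (h B hB n).of_iso_left hS e
  | succ k ih =>
    obtain ⟨B, Z, i, p, w, hB, hip, hZ⟩ := hQ
    exact .left_first hS ⟨w, hip⟩ (h B hB n) (ih hZ _)

/-- A resolution of length `k` raises the projective dimension by at most `k`. -/
lemma extVanish_left_of_res {M : C} {n : ℕ} (h : ∀ T, 𝒯 T → ∀ j, n ≤ j → ExtVanish S j T M)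
    {k : ℕ} {Q : C} (hQ : Res S 𝒯 k Q) {j : ℕ} (hj : n + k ≤ j) : ExtVanish S j Q M := by
  induction k generalizing Q j with
  | zero =>
    obtain ⟨B, hB, ⟨e⟩⟩ := hQ
    exact (h B hB j hj).of_iso_left hS e.symm
  | succ k ih =>
    obtain ⟨Z, B, i, p, w, hB, hip, hZ⟩ := hQ
    obtain ⟨j, rfl⟩ : ∃ l, j = l + 1 := ⟨j - 1, by omega⟩
    exact .left_third hS ⟨w, hip⟩ (ih hZ (by omega)) (h B hB _ (by omega))

/-- If every object embeds into an object of `𝒰^⊥`, then objects `M` with `Ext^j(𝒰, M) = 0` for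
`j > k` have a coresolution of length `k` by objects of `𝒰^⊥`. -/
lemma cores_perp_of_extVanish
    (hemb : ∀ M : C, ∃ (B Z : C) (i : M ⟶ B) (p : B ⟶ Z), IsConf S i p ∧ perp S 𝒰 B)
    {k : ℕ} {M : C} (h : ∀ U, 𝒰 U → ∀ j, k ≤ j → ExtVanish S j U M) :
    Cores S (perp S 𝒰) k M := by
  induction k generalizing M with
  | zero => exact ⟨M, fun U hU n => h U hU n (Nat.zero_le _), ⟨Iso.refl _⟩⟩
  | succ k ih =>
    obtain ⟨B, Z, i, p, hip, hB⟩ := hemb M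
    exact cores_succ hip hB (ih fun U hU j hj =>
      .right_third hS hip (hB U hU j) (h U hU _ (by omega)))

/-- The horseshoe lemma: the objects with a coresolution of length `k` by objects of a
self-orthogonal subcategory are closed under extensions. -/
lemma cores_extClosed (hself : SelfOrthogonal S 𝒰) (hE : ExtClosed S 𝒰)
    (h0 : ∀ Z, IsZero Z → 𝒰 Z) (k : ℕ) : ExtClosed S (Cores S 𝒰 k) := by
  induction k with
  | zero =>
    rintro A B D i p h ⟨A', hA', ⟨e⟩⟩ ⟨D', hD', ⟨e'⟩⟩
    exact ⟨B, hE i p h (hE.of_iso hS h0 e.symm hA') (hE.of_iso hS h0 e'.symm hD'), ⟨Iso.refl _⟩⟩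
  | succ k ih =>
    rintro A B D i p h ⟨U, A', j, q, w, hU, hj, hA'⟩ hD
    have hDU : ExtVanish S 0 D U :=
      extVanish_left_of_cores hS (fun V hV n => hself _ hU V hV n) hD 0
    obtain ⟨V, D', l, r, w', hV, hl, hD'⟩ := hD
    have hj : IsConf S j q := ⟨w, hj⟩
    have hl : IsConf S l r := ⟨w', hl⟩
    -- `P` is the pushout of `B` and `U`; it is an extension of `D` by `U`, hence split
    obtain ⟨P, a, b, c, d, hab, hcd, -⟩ := h.pushout_pushout hS hj
    obtain ⟨s, hs⟩ := (extVanish_zero_iff hS).1 hDU c d hcd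
    obtain ⟨t, -, hst⟩ := hcd.swap_of_section hS s hs
    obtain ⟨P', a', b', c', d', hab', hcd', -⟩ := hst.pushout_pushout hS hl
    obtain ⟨B', e, f, g, he, hfg, -⟩ := hab.comp_inflation hS hab'
    exact cores_succ he (hE c' d' hcd' hV hU) (ih f g hfg hA' hD')

/-- An object of `𝒰^⊥` without first extensions by `𝒰^⊥` is projective in `𝒰^⊥`. -/
lemma isProj_perp {X : C} (hX : perp S 𝒰 X)
    (h : ∀ Y, perp S 𝒰 Y → ExtVanish S 0 X Y) :
    IsProj (restrict S (perp S 𝒰)) ⟨X, hX⟩ := by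
  rintro B Z p ⟨A, i, hip⟩ f
  have hip := (isConf_restrict_iff i p).1 hip
  obtain ⟨g, hg⟩ := (h _ A.2).exists_lift hS hip f.hom
  exact ⟨ObjectProperty.homMk g, ObjectProperty.hom_ext _ hg⟩

end Perp

/-! ### Tilting subcategories -/

section Tilting

variable {C : Type u} [Category.{v} C] [Preadditive C] {S : ObjectProperty (ShortComplex C)}
  {𝒯 𝒰 : ObjectProperty C}

lemma IsTilting.mem_iff (h : IsTilting S 𝒯) (X : C) :
    𝒯 X ↔ ∃ hX : perp S 𝒯 X, IsProj (restrict S (perp S 𝒯)) ⟨X, hX⟩ :=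
  ⟨fun hX => ⟨h.selfOrthogonal X hX, (h.isProj_iff ⟨X, _⟩).2 hX⟩,
    fun ⟨_, hP⟩ => (h.isProj_iff _).1 hP⟩

/-- A tilting subcategory is determined by its perpendicular category. -/
lemma IsTilting.eq_of_perp_eq (h : IsTilting S 𝒯) (h' : IsTilting S 𝒰)
    (e : perp S 𝒰 = perp S 𝒯) : 𝒰 = 𝒯 := by
  ext X
  rw [h.mem_iff, h'.mem_iff, e]

/-- Objects of `𝒯^⊥` are quotients of objects of `𝒯`, with kernel in `𝒯^⊥`. -/
lemma IsTilting.exists_res (h : IsTilting S 𝒯) {X : C} (hX : perp S 𝒯 X) :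
    ∃ (X₁ T : C) (i : X₁ ⟶ T) (p : T ⟶ X), perp S 𝒯 X₁ ∧ 𝒯 T ∧ IsConf S i p := by
  obtain ⟨T, p, hT, X₁, i, hip⟩ := h.enoughProj ⟨X, hX⟩
  exact ⟨_, _, i.hom, p.hom, X₁.2, (h.isProj_iff T).1 hT, (isConf_restrict_iff i p).1 hip⟩

lemma IsTilting.exists_embedding (h : IsTilting S 𝒯) (M : C) :
    ∃ (X Z : C) (i : M ⟶ X) (p : X ⟶ Z), IsConf S i p ∧ perp S 𝒯 X := by
  obtain ⟨X, i, hX, Z, p, w, hip⟩ := h.finitelyCoresolving.1.copres M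
  exact ⟨X, Z, i, p, ⟨w, hip⟩, hX⟩

variable (hS : IsExactStructure S) [HasZeroObject C] [HasBinaryBiproducts C]

open ZeroObject

include hS

lemma IsTilting.zero_mem (h : IsTilting S 𝒯) (Z : C) (hZ : IsZero Z) : 𝒯 Z :=
  (h.mem_iff Z).2 ⟨perp_of_isZero hS Z hZ, isProj_perp hS _ fun Y _ =>
    extVanish_of_isZero_left hS hZ 0 Y⟩

/-- Objects of an `n`-tilting subcategory have projective dimension at most `n`. -/
lemma IsNTilting.extVanish {n : ℕ} (h : IsNTilting S n 𝒯) {T : C} (hT : 𝒯 T) {j : ℕ} (hj : n ≤ j)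
    (M : C) : ExtVanish S j T M :=
  extVanish_of_cores hS (fun _ hB n => hB T hT n) (h.2 M) hj

/-- If `𝒰` is contained in `𝒯^⊥` then `𝒰^⊥` is contained in `𝒯^⊥`: by dimension shift along
resolutions by objects of `𝒰`, the groups `Ext^j(𝒯, 𝒰^⊥)` vanish for all `j` because they vanish
for large `j`. -/
lemma perp_le_of_le_perp {n : ℕ} (h𝒯 : IsNTilting S n 𝒯) (h𝒰 : IsTilting S 𝒰)
    (h : 𝒰 ≤ perp S 𝒯) : perp S 𝒰 ≤ perp S 𝒯 := by
  intro M hM T hT j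
  have key : ∀ l j M, n ≤ j + l → perp S 𝒰 M → ExtVanish S j T M := by
    intro l
    induction l with
    | zero => exact fun j M hj _ => h𝒯.extVanish hS hT hj M
    | succ l ih =>
      intro j M hj hM
      obtain ⟨M₁, U, i, p, hM₁, hU, hip⟩ := h𝒰.exists_res hM
      exact .right_third hS hip (h U hU T hT j) (ih (j + 1) M₁ (by omega) hM₁)
  exact key n j M (by omega) hM

/-- Approximation by the coresolving subcategory `𝒰^⊥`. -/
lemma IsTilting.exists_approximation (h : IsTilting S 𝒰) {m : ℕ} {M : C}
    (hM : Cores S (perp S 𝒰) m M) :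
    ∃ (W Q : C) (i : M ⟶ W) (p : W ⟶ Q), IsConf S i p ∧ perp S 𝒰 W ∧ Cores S 𝒰 m Q := by
  induction m generalizing M with
  | zero =>
    obtain ⟨X, hX, ⟨e⟩⟩ := hM
    exact ⟨X, 0, e.hom, 0, isConf_of_isIso_of_isZero hS _ (isZero_zero C) 0, hX,
      0, h.zero_mem hS _ (isZero_zero C), ⟨Iso.refl _⟩⟩
  | succ m ih =>
    obtain ⟨Y, M', i, p, w, hY, hip, hM'⟩ := hM
    have hip : IsConf S i p := ⟨w, hip⟩
    obtain ⟨Y', P, j, q, hjq, hY', hP⟩ := ih hM'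
    obtain ⟨Z, U, k, r, hZ, hU, hkr⟩ := h.exists_res hY'
    -- `Q` is the preimage of `M'` in `U`
    obtain ⟨Q, a, b, c, hQ, hZQ, -⟩ := hkr.comp_deflation hS hjq
    obtain ⟨W, a', b', c', d', hW, hW', -⟩ := hip.pullback_pullback hS hZQ
    exact ⟨W, Q, a', b', hW, perp_extClosed hS c' d' hW' hZ hY, cores_succ hQ hU hP⟩

/-- Objects without extensions by `𝒰^⊥` have a finite coresolution by objects of `𝒰`. -/
lemma IsNTilting.cores_of_extVanish {m : ℕ} (h : IsNTilting S m 𝒰) {T : C}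
    (hT : ∀ Y, perp S 𝒰 Y → ∀ n, ExtVanish S n T Y) : Cores S 𝒰 (m + 1) T := by
  obtain ⟨W, Q, i, p, hip, hW, hQ⟩ := h.1.exists_approximation hS (h.2 T)
  refine cores_succ hip ((h.1.mem_iff W).2 ⟨hW, isProj_perp hS hW fun Y hY => ?_⟩) hQ
  exact .left_middle hS hip (hT Y hY 0)
    (extVanish_left_of_cores hS (fun V hV n => hY V hV n) hQ 0)

end Tilting

/-! ### A criterion for tilting subcategories -/

section Criterion

variable {C : Type u} [Category.{v} C] [Preadditive C] {S : ObjectProperty (ShortComplex C)}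
  {𝒯 𝒰 : ObjectProperty C} (hS : IsExactStructure S) [HasZeroObject C] [HasBinaryBiproducts C]

open ZeroObject

include hS

/-- One step in the construction of embeddings into `𝒰^⊥`: if `X₁ ⟶ T ⟶ X` is a conflation, `T` has
a finite coresolution by `𝒰`, and `X₁` embeds into `B₁` with a cokernel that has one too, then `X`
embeds, with such a cokernel, into a quotient `U/B₁` with `U` in `𝒰`. -/
lemma exists_embedding_step (hself : SelfOrthogonal S 𝒰) (hE : ExtClosed S 𝒰)
    (h0 : ∀ Z, IsZero Z → 𝒰 Z) {X₁ T X B₁ C₁ : C} {i : X₁ ⟶ T} {p : T ⟶ X} (hip : IsConf S i p)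
    {j : X₁ ⟶ B₁} {q : B₁ ⟶ C₁} (hjq : IsConf S j q) {k l : ℕ} (hT : Cores S 𝒰 k T)
    (hC₁ : Cores S 𝒰 l C₁) :
    ∃ (B D U : C) (a : X ⟶ B) (b : B ⟶ D) (c : B₁ ⟶ U) (d : U ⟶ B),
      IsConf S a b ∧ (∃ m, Cores S 𝒰 m D) ∧ IsConf S c d ∧ 𝒰 U := by
  obtain ⟨T', a, b, c, d, hab, hcd, -⟩ := hip.pushout_pushout hS hjq
  have hT' : Cores S 𝒰 (max k l + 1) T' := cores_le_succ hS h0 _ _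
    (cores_extClosed hS hself hE h0 _ a b hab (cores_mono hS h0 (le_max_left k l) _ hT)
      (cores_mono hS h0 (le_max_right k l) _ hC₁))
  obtain ⟨U, D, e, f, w, hU, hef, hD⟩ := hT'
  obtain ⟨B, r, s, t, hr, hst, -⟩ := hcd.comp_inflation hS ⟨w, hef⟩
  exact ⟨B, D, U, s, t, _, r, hst, ⟨_, hD⟩, hr, hU⟩

/-- The key construction: an object `X` of `𝒯^⊥` embeds into an object `B` with
`Ext^j(𝒰, B) = 0` for `j + k > N`, with a cokernel that has a finite coresolution by `𝒰`. -/
lemma exists_embedding_of_res (hself : SelfOrthogonal S 𝒰) (hE : ExtClosed S 𝒰)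
    (h0 : ∀ Z, IsZero Z → 𝒰 Z) {N : ℕ}
    (hres : ∀ X, perp S 𝒯 X →
      ∃ (X₁ T : C) (i : X₁ ⟶ T) (p : T ⟶ X), perp S 𝒯 X₁ ∧ 𝒯 T ∧ IsConf S i p)
    (hcores : ∀ T, 𝒯 T → ∃ k, Cores S 𝒰 k T)
    (hpd : ∀ U, 𝒰 U → ∀ j, N ≤ j → ∀ M, ExtVanish S j U M) (k : ℕ) {X : C}
    (hX : perp S 𝒯 X) :
    ∃ (B D : C) (a : X ⟶ B) (b : B ⟶ D), IsConf S a b ∧ (∃ m, Cores S 𝒰 m D) ∧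
      ∀ U, 𝒰 U → ∀ j, N ≤ j + k → ExtVanish S j U B := by
  induction k generalizing X with
  | zero =>
    exact ⟨X, 0, 𝟙 X, 0, isConf_of_isIso_of_isZero hS _ (isZero_zero C) 0,
      ⟨0, 0, h0 _ (isZero_zero C), ⟨Iso.refl _⟩⟩, fun U hU j hj => hpd U hU j hj X⟩
  | succ k ih =>
    obtain ⟨X₁, T, i, p, hX₁, hT, hip⟩ := hres X hX
    obtain ⟨B₁, C₁, j, q, hjq, ⟨l, hl⟩, hB₁⟩ := ih hX₁
    obtain ⟨m, hm⟩ := hcores T hT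
    obtain ⟨B, D, U, a, b, c, d, hab, hD, hcd, hU⟩ :=
      exists_embedding_step hS hself hE h0 hip hjq hm hl
    exact ⟨B, D, a, b, hab, hD, fun V hV j hj => .right_third hS hcd (hself U hU V hV j)
      (hB₁ V hV (j + 1) (by omega))⟩

/-- Let `𝒯` be such that `𝒯^⊥` has resolutions by objects of `𝒯` and every object embeds into
`𝒯^⊥`. A self-orthogonal subcategory `𝒰` closed under extensions and direct summands is
tilting if its objects have bounded projective dimension and the objects of `𝒯` have finite
coresolutions by objects of `𝒰`. -/
theorem isNTilting_of_cores (hself : SelfOrthogonal S 𝒰) (hE : ExtClosed S 𝒰)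
    (h0 : ∀ Z, IsZero Z → 𝒰 Z)
    (hsum : ∀ ⦃A B D : C⦄ (i : A ⟶ B) (p : B ⟶ D) (s : D ⟶ B), IsConf S i p → s ≫ p = 𝟙 D →
      𝒰 B → 𝒰 D) {N : ℕ} (hN : 1 ≤ N)
    (hres : ∀ X, perp S 𝒯 X →
      ∃ (X₁ T : C) (i : X₁ ⟶ T) (p : T ⟶ X), perp S 𝒯 X₁ ∧ 𝒯 T ∧ IsConf S i p)
    (hemb : ∀ M : C, ∃ (X Z : C) (i : M ⟶ X) (p : X ⟶ Z), IsConf S i p ∧ perp S 𝒯 X)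
    (hcores : ∀ T, 𝒯 T → ∃ k, Cores S 𝒰 k T)
    (hpd : ∀ U, 𝒰 U → ∀ j, N ≤ j → ∀ M, ExtVanish S j U M) : IsNTilting S N 𝒰 := by
  have hle : perp S 𝒰 ≤ perp S 𝒯 := fun M hM T hT n => by
    obtain ⟨k, hk⟩ := hcores T hT
    exact extVanish_left_of_cores hS (fun U hU n => hM U hU n) hk n
  have hemb' : ∀ M : C, ∃ (B Z : C) (i : M ⟶ B) (p : B ⟶ Z), IsConf S i p ∧ perp S 𝒰 B := by
    intro M
    obtain ⟨X, Z, i, p, hip, hX⟩ := hemb M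
    obtain ⟨B, D, a, b, hab, -, hB⟩ :=
      exists_embedding_of_res hS hself hE h0 hres hcores hpd N hX
    obtain ⟨P, r, -, -, hr, -⟩ := hip.comp_inflation hS hab
    exact ⟨B, P, _, r, hr, fun U hU j => hB U hU j (Nat.le_add_left _ _)⟩
  have hcoresM : ∀ M, Cores S (perp S 𝒰) N M := fun M =>
    cores_perp_of_extVanish hS hemb' fun U hU j hj => hpd U hU j hj M
  have hproj : ∀ U (hU : 𝒰 U), IsProj (restrict S (perp S 𝒰)) ⟨U, hself U hU⟩ := fun U hU =>
    isProj_perp hS _ fun Y hY => hY U hU 0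
  have henough : ∀ M, perp S 𝒰 M →
      ∃ (K U : C) (i : K ⟶ U) (p : U ⟶ M), perp S 𝒰 K ∧ 𝒰 U ∧ IsConf S i p := by
    intro M hM
    obtain ⟨X₁, T, i, p, hX₁, hT, hip⟩ := hres M (hle M hM)
    obtain ⟨B₁, C₁, j, q, hjq, ⟨l, hl⟩, hB₁⟩ :=
      exists_embedding_of_res hS hself hE h0 hres hcores hpd N hX₁
    obtain ⟨m, hm⟩ := hcores T hT
    obtain ⟨B, D, U, a, b, c, d, hab, ⟨k, hD⟩, hcd, hU⟩ :=
      exists_embedding_step hS hself hE h0 hip hjq hm hl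
    have hB₁ : perp S 𝒰 B₁ := fun V hV j => hB₁ V hV j (Nat.le_add_left _ _)
    have hB : perp S 𝒰 B := perp_cokerClosed hS c d hcd hB₁ (hself U hU)
    -- the embedding of `M` into `B` splits, so `M` is a quotient of `U`
    obtain ⟨s, hs⟩ := (extVanish_zero_iff hS).1
      (extVanish_left_of_cores hS (fun V hV n => hM V hV n) hD 0) a b hab
    obtain ⟨r, -, hsr⟩ := hab.swap_of_section hS s hs
    obtain ⟨K, e, f, g, he, hfg, -⟩ := hcd.comp_deflation hS hsr
    exact ⟨K, U, e, _, perp_extClosed hS f g hfg hB₁ (perp_cokerClosed hS a b hab hM hB), hU, he⟩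
  refine ⟨⟨hself, ?_, ?_, ⟨?_, ?_, ?_⟩, fun M => ⟨N, hN, hcoresM M⟩⟩, hcoresM⟩
  · rintro ⟨M, hM⟩
    obtain ⟨K, U, i, p, hK, hU, hip⟩ := henough M hM
    exact ⟨⟨U, hself U hU⟩, ObjectProperty.homMk p, hproj U hU, ⟨K, hK⟩,
      ObjectProperty.homMk i, (isConf_restrict_iff _ _).2 hip⟩
  · rintro ⟨X, hX⟩
    refine ⟨fun hP => ?_, fun hU => hproj X hU⟩
    obtain ⟨K, U, i, p, hK, hU, hip⟩ := henough X hX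
    obtain ⟨s, hs⟩ := hP (B := ⟨U, hself U hU⟩) (Z := ⟨X, hX⟩) (ObjectProperty.homMk p)
      ⟨⟨K, hK⟩, ObjectProperty.homMk i, (isConf_restrict_iff _ _).2 hip⟩ (𝟙 _)
    exact hsum i p s.hom hip (congrArg (·.hom) hs) hU
  · exact fun E h h₁ h₃ => perp_extClosed hS E.f E.g ⟨E.zero, h⟩ h₁ h₃
  · exact fun E h h₁ h₂ => perp_cokerClosed hS E.f E.g ⟨E.zero, h⟩ h₁ h₂
  · intro M
    obtain ⟨B, Z, i, p, hip, hB⟩ := hemb' M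
    exact ⟨B, i, hB, Z, p, hip⟩

end Criterion

/-! ### Resolutions and coresolutions in fully exact subcategories -/

section Inside

variable {C : Type u} [Category.{v} C] [Preadditive C] {S : ObjectProperty (ShortComplex C)}
  {𝒯 𝒰 𝒳 : ObjectProperty C}

lemma cores_of_cores_restrict {k : ℕ} {M : 𝒳.FullSubcategory}
    (h : Cores (restrict S 𝒳) (inside 𝒳 𝒰) k M) : Cores S 𝒰 k M.obj := by
  induction k generalizing M with
  | zero =>
    obtain ⟨X, hX, ⟨e⟩⟩ := h
    exact ⟨X.obj, hX, ⟨𝒳.ι.mapIso e⟩⟩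
  | succ k ih =>
    obtain ⟨X, Z, i, p, w, hX, hip, hZ⟩ := h
    exact cores_succ ((isConf_restrict_iff i p).1 ⟨w, hip⟩) hX (ih hZ)

lemma res_of_res_restrict {k : ℕ} {M : 𝒳.FullSubcategory}
    (h : Res (restrict S 𝒳) (inside 𝒳 𝒯) k M) : Res S 𝒯 k M.obj := by
  induction k generalizing M with
  | zero =>
    obtain ⟨X, hX, ⟨e⟩⟩ := h
    exact ⟨X.obj, hX, ⟨𝒳.ι.mapIso e⟩⟩
  | succ k ih =>
    obtain ⟨Z, X, i, p, w, hX, hip, hZ⟩ := h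
    exact res_succ ((isConf_restrict_iff i p).1 ⟨w, hip⟩) hX (ih hZ)

lemma cores_restrict_of_cores (h𝒳 : CokerClosed S 𝒳) (h : 𝒰 ≤ 𝒳) {k : ℕ} {M : C} (hM : 𝒳 M)
    (hk : Cores S 𝒰 k M) : Cores (restrict S 𝒳) (inside 𝒳 𝒰) k ⟨M, hM⟩ := by
  induction k generalizing M with
  | zero =>
    obtain ⟨X, hX, ⟨e⟩⟩ := hk
    exact ⟨⟨X, h X hX⟩, hX, ⟨ObjectProperty.isoMk _ e⟩⟩
  | succ k ih =>
    obtain ⟨X, Z, i, p, w, hX, hip, hZ⟩ := hk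
    have hip : IsConf S i p := ⟨w, hip⟩
    exact cores_succ (X := ⟨X, h X hX⟩) (Z := ⟨Z, h𝒳 i p hip hM (h X hX)⟩)
      (i := ObjectProperty.homMk i) (p := ObjectProperty.homMk p)
      ((isConf_restrict_iff _ _).2 hip) hX (ih _ hZ)

variable (hS : IsExactStructure S) [HasBinaryBiproducts C]

include hS

lemma ClosedUnderSummands.of_section (h𝒰 : ClosedUnderSummands 𝒰) {A B D : C} (i : A ⟶ B)
    (p : B ⟶ D) (s : D ⟶ B) (h : IsConf S i p) (hs : s ≫ p = 𝟙 D) (hB : 𝒰 B) : 𝒰 D := by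
  obtain ⟨e⟩ := h.iso_biprod hS s hs
  exact h𝒰 D A B ⟨e ≪≫ biprod.braiding A D⟩ hB

variable [HasZeroObject C]

/-- Objects of `𝒯^⊥` of finite projective dimension with respect to `𝒯^⊥` have a finite resolution
by objects of `𝒯`. -/
lemma IsTilting.resIn_of_extVanish (h : IsTilting S 𝒯) {k : ℕ} {X : C} (hX : perp S 𝒯 X)
    (hk : ∀ M, perp S 𝒯 M → ∀ j, k ≤ j → ExtVanish S j X M) : ResIn S (perp S 𝒯) k 𝒯 X := by
  refine ⟨hX, ?_⟩
  induction k generalizing X with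
  | zero => exact ⟨⟨X, hX⟩, (h.mem_iff X).2 ⟨hX, isProj_perp hS hX fun Y hY => hk Y hY 0 le_rfl⟩,
      ⟨Iso.refl _⟩⟩
  | succ k ih =>
    obtain ⟨X₁, T, i, p, hX₁, hT, hip⟩ := h.exists_res hX
    refine res_succ (X := ⟨T, h.selfOrthogonal T hT⟩) (Z := ⟨X₁, hX₁⟩)
      (i := ObjectProperty.homMk i) (p := ObjectProperty.homMk p)
      ((isConf_restrict_iff _ _).2 hip) hT (ih hX₁ fun M hM j hj => ?_)
    exact .left_first hS hip (hM T hT j) (hk M hM (j + 1) (by omega))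

lemma isExactStructure_restrict_perp : IsExactStructure (restrict S (perp S 𝒯)) :=
  isExactStructure_restrict hS (perp_extClosed hS) (perp_of_isZero hS)

lemma hasZeroObject_perp : HasZeroObject (perp S 𝒯).FullSubcategory := by
  have : (perp S 𝒯).ContainsZero :=
    ⟨_, isZero_zero C, perp_of_isZero hS _ (isZero_zero C)⟩
  infer_instance

lemma hasBinaryBiproducts_perp : HasBinaryBiproducts (perp S 𝒯).FullSubcategory :=
  hasBinaryBiproducts_fullSubcategory ((perp_extClosed hS).biprod hS)

/-- Objects of `𝒯` have no extensions inside `𝒯^⊥`. -/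
lemma IsTilting.extVanish_restrict (h : IsTilting S 𝒯) {T : (perp S 𝒯).FullSubcategory}
    (hT : 𝒯 T.obj) (n : ℕ) (X : (perp S 𝒯).FullSubcategory) :
    ExtVanish (restrict S (perp S 𝒯)) n T X := by
  have := hasZeroObject_perp hS (𝒯 := 𝒯)
  have := hasBinaryBiproducts_perp hS (𝒯 := 𝒯)
  exact extVanish_of_isProj (isExactStructure_restrict_perp hS) ((h.isProj_iff T).2 hT) n X

/-- Vanishing of extension groups of objects of `𝒯^⊥` can be tested in `𝒯^⊥`. -/
lemma IsTilting.extVanish_iff (h : IsTilting S 𝒯) (n : ℕ) (X Y : (perp S 𝒯).FullSubcategory) :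
    ExtVanish S n X.obj Y.obj ↔ ExtVanish (restrict S (perp S 𝒯)) n X Y := by
  refine extVanish_restrict_iff hS (perp_extClosed hS) (perp_of_isZero hS) (𝒯 := 𝒯)
    (fun T Y hT n => ⟨Y.2 T.obj hT n, h.extVanish_restrict hS hT n Y⟩) (fun X => ?_) n X Y
  obtain ⟨T, p, hT, X₁, i, hip⟩ := h.enoughProj X
  exact ⟨X₁, T, i, p, (h.isProj_iff T).1 hT, hip⟩

lemma IsAdditive.extClosed (h𝒰 : IsAdditive 𝒰) (hself : SelfOrthogonal S 𝒰) :
    ExtClosed S 𝒰 := fun A B D i p h hA hD => by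
  obtain ⟨s, hs⟩ := (extVanish_zero_iff hS).1 (hself A hA D hD 0) i p h
  exact h𝒰.sum_mem A D B hA hD (h.iso_biprod hS s hs)

/-- If `𝒰` is tilting in `𝒯^⊥`, the objects of `𝒰` have finite resolutions by objects of `𝒯`. -/
lemma IsTilting.le_resIn (h : IsTilting S 𝒯) {m : ℕ}
    (h𝒰 : IsNTiltingIn S (perp S 𝒯) m 𝒰) : 𝒰 ≤ ResIn S (perp S 𝒯) (m + 1) 𝒯 := by
  have hX := isExactStructure_restrict_perp hS (𝒯 := 𝒯)
  have := hasZeroObject_perp hS (𝒯 := 𝒯)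
  have := hasBinaryBiproducts_perp hS (𝒯 := 𝒯)
  refine fun U hU => h.resIn_of_extVanish hS (h𝒰.1 U hU) fun M hM j hj => ?_
  exact (h.extVanish_iff hS j ⟨U, h𝒰.1 U hU⟩ ⟨M, hM⟩).2
    (h𝒰.2.extVanish hX (T := ⟨U, h𝒰.1 U hU⟩) hU (by omega) _)

/-- If `𝒰` is tilting in `𝒯^⊥`, the objects of `𝒯` have finite coresolutions by objects of `𝒰`. -/
lemma IsTilting.le_coresIn (h : IsTilting S 𝒯) {m : ℕ}
    (h𝒰 : IsNTiltingIn S (perp S 𝒯) m 𝒰) : 𝒯 ≤ CoresIn S (perp S 𝒯) (m + 1) 𝒰 := by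
  have hX := isExactStructure_restrict_perp hS (𝒯 := 𝒯)
  have := hasZeroObject_perp hS (𝒯 := 𝒯)
  have := hasBinaryBiproducts_perp hS (𝒯 := 𝒯)
  exact fun T hT => ⟨h.selfOrthogonal T hT, h𝒰.2.cores_of_extVanish hX
    (T := ⟨T, h.selfOrthogonal T hT⟩) fun Y _ n => h.extVanish_restrict hS hT n Y⟩

variable (h𝒰 : IsAdditive 𝒰) (h𝒰s : ClosedUnderSummands 𝒰) (hself : SelfOrthogonal S 𝒰)

include h𝒰 h𝒰s hself

/-- Tilting in `C` from resolutions in `𝒯^⊥`. -/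
lemma isNTilting_of_resIn_coresIn {n m : ℕ} (h𝒯 : IsNTilting S n 𝒯)
    (h₁ : 𝒰 ≤ ResIn S (perp S 𝒯) m 𝒯) (h₂ : 𝒯 ≤ CoresIn S (perp S 𝒯) m 𝒰) :
    IsNTilting S (n + m + 1) 𝒰 := by
  refine isNTilting_of_cores hS hself (h𝒰.extClosed hS hself) h𝒰.zero_mem
    (fun _ _ _ => h𝒰s.of_section hS) (Nat.le_add_left _ _) (fun X hX => h𝒯.1.exists_res hX)
    h𝒯.1.exists_embedding (fun T hT => ?_) (fun U hU j hj M => ?_)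
  · obtain ⟨_, h⟩ := h₂ T hT
    exact ⟨m, cores_of_cores_restrict h⟩
  · obtain ⟨_, h⟩ := h₁ U hU
    exact extVanish_left_of_res hS (fun T hT j hj => h𝒯.extVanish hS hT hj M)
      (res_of_res_restrict h) (by omega)

/-- Tilting in `𝒯^⊥` from resolutions in `𝒯^⊥`, in which `𝒯` consists of the projectives. -/
lemma isNTiltingIn_of_resIn_coresIn {n m : ℕ} (h𝒯 : IsNTilting S n 𝒯)
    (h₁ : 𝒰 ≤ ResIn S (perp S 𝒯) m 𝒯) (h₂ : 𝒯 ≤ CoresIn S (perp S 𝒯) m 𝒰) :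
    IsNTiltingIn S (perp S 𝒯) (n + m + 1) 𝒰 := by
  have hX := isExactStructure_restrict_perp hS (𝒯 := 𝒯)
  have := hasZeroObject_perp hS (𝒯 := 𝒯)
  have := hasBinaryBiproducts_perp hS (𝒯 := 𝒯)
  have hperp : ∀ X, perp (restrict S (perp S 𝒯)) (inside (perp S 𝒯) 𝒯) X :=
    fun X T hT n => h𝒯.1.extVanish_restrict hS hT n X
  refine ⟨fun U hU => (h₁ U hU).1, isNTilting_of_cores hX (𝒯 := inside (perp S 𝒯) 𝒯)
    (fun U hU V hV j => (h𝒯.1.extVanish_iff hS j V U).1 (hself _ hU _ hV j))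
    (fun A B D i p h hA hD => h𝒰.extClosed hS hself i.hom p.hom
      ((isConf_restrict_iff i p).1 h) hA hD)
    (fun Z hZ => h𝒰.zero_mem _ ?_)
    (fun A B D i p s h hs hB => h𝒰s.of_section hS i.hom p.hom s.hom
      ((isConf_restrict_iff i p).1 h) (congrArg (·.hom) hs) hB)
    (Nat.le_add_left _ _) (fun X _ => ?_)
    (fun M => ⟨M, _, 𝟙 M, 0, isConf_of_isIso_of_isZero hX _ (isZero_zero _) 0, hperp M⟩)
    (fun T hT => ?_) (fun U hU j hj M => ?_)⟩
  · rw [IsZero.iff_id_eq_zero] at hZ ⊢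
    exact congrArg (·.hom) hZ
  · obtain ⟨T, p, hT, X₁, i, hip⟩ := h𝒯.1.enoughProj X
    exact ⟨X₁, T, i, p, hperp X₁, (h𝒯.1.isProj_iff T).1 hT, hip⟩
  · obtain ⟨_, h⟩ := h₂ T.obj hT
    exact ⟨m, h⟩
  · obtain ⟨_, h⟩ := h₁ U.obj hU
    exact (h𝒯.1.extVanish_iff hS j U M).1 (extVanish_left_of_res hS
      (fun T hT j hj => h𝒯.extVanish hS hT hj M.obj) (res_of_res_restrict h) (by omega))

end Inside

end ExactCat

theorem mainTheorem11 {C : Type u} [Category.{v} C] [Preadditive C]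
    [HasZeroObject C] [HasBinaryBiproducts C]
    (S : ObjectProperty (ShortComplex C)) (hS : ExactCat.IsExactStructure S) :
    -- the equivalent descriptions of the relation `𝒰 ≤ 𝒯`
    (∀ (n : ℕ) (𝒯 𝒰 : ObjectProperty C), ExactCat.IsNTilting S n 𝒯 →
      ExactCat.IsAdditive 𝒰 → ExactCat.ClosedUnderSummands 𝒰 → ExactCat.SelfOrthogonal S 𝒰 →
      List.TFAE [
        (∃ m : ℕ, ExactCat.IsNTilting S m 𝒰) ∧ ExactCat.perp S 𝒰 ≤ ExactCat.perp S 𝒯,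
        (∃ m : ℕ, ExactCat.IsNTilting S m 𝒰) ∧ 𝒰 ≤ ExactCat.perp S 𝒯,
        ∃ m : ℕ, ExactCat.IsNTiltingIn S (ExactCat.perp S 𝒯) m 𝒰,
        ∃ m : ℕ, 𝒰 ≤ ExactCat.ResIn S (ExactCat.perp S 𝒯) m 𝒯 ∧
          𝒯 ≤ ExactCat.CoresIn S (ExactCat.perp S 𝒯) m 𝒰]) ∧
    -- inclusion of perpendicular categories is a partial order on all tilting subcategories
    IsPartialOrder {𝒯 : ObjectProperty C // ExactCat.IsTilting S 𝒯}
      (fun 𝒰 𝒯 => ExactCat.perp S 𝒰.1 ≤ ExactCat.perp S 𝒯.1) ∧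
    -- `𝒰 ≤ 𝒯` is a partial order on the subcategories that are `n`-tilting for some `n`
    IsPartialOrder {𝒯 : ObjectProperty C // ∃ n : ℕ, ExactCat.IsNTilting S n 𝒯}
      (fun 𝒰 𝒯 => ExactCat.TiltLE S 𝒰.1 𝒯.1) ∧
    -- subcategories that are `n`-tilting for some `n` are maximal under inclusion among each other
    (∀ (n m : ℕ) (𝒯 𝒰 : ObjectProperty C), ExactCat.IsNTilting S n 𝒯 →
      ExactCat.IsNTilting S m 𝒰 → 𝒰 ≤ 𝒯 → 𝒰 = 𝒯) := by
  refine ⟨fun n 𝒯 𝒰 h𝒯 h𝒰 h𝒰s hself => ?_, ?_, ?_, fun n m 𝒯 𝒰 h𝒯 h𝒰 hle => ?_⟩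
  · tfae_have 1 → 2 := fun ⟨h, hle⟩ => ⟨h, hself.trans hle⟩
    tfae_have 2 → 1 := fun ⟨⟨m, h⟩, hle⟩ => ⟨⟨m, h⟩, ExactCat.perp_le_of_le_perp hS h𝒯 h.1 hle⟩
    tfae_have 1 → 4 := by
      rintro ⟨⟨m, h⟩, hle⟩
      refine ⟨m + 1, fun U hU => ?_, fun T hT => ?_⟩
      · exact h𝒯.1.resIn_of_extVanish hS (hle _ (hself U hU)) fun M _ j hj =>
          h.extVanish hS hU (by omega) M
      · exact ⟨h𝒯.1.selfOrthogonal T hT,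
          ExactCat.cores_restrict_of_cores (ExactCat.perp_cokerClosed hS)
          (hself.trans hle) _ (h.cores_of_extVanish hS fun Y hY n => hle Y hY T hT n)⟩
    tfae_have 4 → 2 := by
      rintro ⟨m, h₁, h₂⟩
      exact ⟨⟨_, ExactCat.isNTilting_of_resIn_coresIn hS h𝒰 h𝒰s hself h𝒯 h₁ h₂⟩,
        fun U hU => (h₁ U hU).1⟩
    tfae_have 4 → 3 := fun ⟨m, h₁, h₂⟩ =>
      ⟨_, ExactCat.isNTiltingIn_of_resIn_coresIn hS h𝒰 h𝒰s hself h𝒯 h₁ h₂⟩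
    tfae_have 3 → 4 := fun ⟨m, h⟩ => ⟨m + 1, h𝒯.1.le_resIn hS h, h𝒯.1.le_coresIn hS h⟩
    tfae_finish
  · exact
      { refl := fun _ => le_rfl
        trans := fun _ _ _ h h' => h.trans h'
        antisymm := fun 𝒰 𝒯 h h' => Subtype.ext (𝒯.2.eq_of_perp_eq 𝒰.2 (le_antisymm h h')) }
  · exact
      { refl := fun 𝒯 => ⟨𝒯.2, le_rfl⟩
        trans := fun _ _ _ h h' => ⟨h.1, h.2.trans h'.2⟩
        antisymm := fun 𝒰 𝒯 h h' => by
          obtain ⟨⟨n, hn⟩, ⟨m, hm⟩⟩ := And.intro 𝒰.2 𝒯.2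
          exact Subtype.ext (hm.1.eq_of_perp_eq hn.1 (le_antisymm h.2 h'.2)) }
  · exact h𝒯.1.eq_of_perp_eq h𝒰.1 (le_antisymm
      (ExactCat.perp_le_of_le_perp hS h𝒯 h𝒰.1 (hle.trans h𝒯.1.selfOrthogonal))
      (fun M hM U hU => hM U (hle U hU)))
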